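/- Let $d\in\{2,3\}$ and let $T\subset\mathbb{R}^d$ be a polyhedral mesh element, i.e. a nonempty bounded open set with a finite set $\mathcal{F}_T$ of pairwise disjoint planar faces such that: $\partial T=\bigcup_{F\in\mathcal{F}_T}\overline{F}$; each $F\in\mathcal{F}_T$ is a nonempty relatively open subset of a hyperplane, with relative boundary of zero $(d-1)$-dimensional measure; and, for each $F\in\mathcal{F}_T$, there is a constant unit vector $\boldsymbol{n}_{TF}$ normal to $F$ which at almost every point of $F$ points out of $T$, $T$ lying locally only on the side opposite to $\boldsymbol{n}_{TF}$. For $X=T$ or $X=F\in\mathcal{F}_T$ let $|X|$ denote its ($d$- or $(d-1)$-dimensional) Hausdorff measure, and let $\pi_X^0$ be the $L^2$-orthogonal projector onto constant functions on $X$, $\pi_X^0w=\frac1{|X|}\int_Xw$, applied component-wise to vector- and tensor-valued functions. For a vector field $\boldsymbol{z}=(z_i)_i$ write $\boldsymbol{\nabla}\boldsymbol{z}=(\partial_jz_i)_{i,j}$. Let $\mathbb{P}^1(T;\mathbb{R}^m)$ be the space of (restrictions to $T$ of) polynomials of total degree at most $1$ with values in $\mathbb{R}^m$. The local interpolate of $\boldsymbol{v}\in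 H^1(T;\mathbb{R}^d)$ is the family of constant vectors $$\boldsymbol{I}_T\boldsymbol{v}=\bigl(\pi_T^0\boldsymbol{v},\,(\pi_F^0\boldsymbol{v}_{|F})_{F\in\mathcal{F}_T}\bigr),$$ where $\boldsymbol{v}_{|F}$ is the trace of $\boldsymbol{v}$ on $F$. Given constant vectors $\underline{\boldsymbol{v}}_T=(\boldsymbol{v}_T,(\boldsymbol{v}_F)_{F\in\mathcal{F}_T})$ of $\mathbb{R}^d$, the displacement reconstruction $\boldsymbol{p}_T\underline{\boldsymbol{v}}_T\in\mathbb{P}^1(T;\mathbb{R}^d)$ is the unique element such that $$\boldsymbol{\nabla}\boldsymbol{p}_T\underline{\boldsymbol{v}}_T=\sum_{F\in\mathcal{F}_T}\frac{|F|}{|T|}(\boldsymbol{v}_F-\boldsymbol{v}_T)\otimes\boldsymbol{n}_{TF}\quad\text{and}\quad\frac1{|T|}\int_T\boldsymbol{p}_T\underline{\boldsymbol{v}}_T=\boldsymbol{v}_T.$$ The elliptic projection $\varpi_T^1w\in\mathbb{P}^1(T;\mathbb{R})$ of $w\in H^1(T;\mathbb{R})$ is the unique element such that $\nabla\varpi_T^1w=\pi_T^0(\nabla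 w)$ and $\frac1{|T|}\int_T\varpi_T^1w=\frac1{|T|}\int_Tw$; its vector version $\boldsymbol{\varpi}_T^1$ acts component-wise. **Proposition 1 (Commutation properties for the displacement reconstruction).** For all $\boldsymbol{v}\in H^1(T;\mathbb{R}^d)$, $$\boldsymbol{\nabla}(\boldsymbol{p}_T\boldsymbol{I}_T\boldsymbol{v})=\pi_T^0(\boldsymbol{\nabla}\boldsymbol{v})\qquad\text{and}\qquad\boldsymbol{p}_T(\boldsymbol{I}_T\boldsymbol{v})=\boldsymbol{\varpi}_T^1\boldsymbol{v}.$$ -/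

import Mathlib

open MeasureTheory Set Filter Topology
open scoped ContDiff

noncomputable section

namespace HHO

/-- The Euclidean space `ℝ^d`. -/
abbrev Eucl (d : ℕ) : Type := EuclideanSpace ℝ (Fin d)

/-- A polyhedral mesh element `T ⊂ ℝ^d` with its set of planar faces and the corresponding unit
normals pointing out of `T`.  Neither convexity, nor star-shapedness, nor any Lipschitz regularity
of the boundary is required. -/
structure PolyhedralElement (d : ℕ) where
  /-- The (open) set `T` itself. -/
  carrier : Set (Eucl d)
  isOpen_carrier : IsOpen carrier
  isBounded_carrier : Bornology.IsBounded carrier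
  nonempty_carrier : carrier.Nonempty
  /-- The finite set of the faces of `T`. -/
  faces : Finset (Set (Eucl d))
  /-- `normal F` is the constant unit normal to the face `F` pointing out of `T` (its values on sets
  that are not faces are irrelevant). -/
  normal : Set (Eucl d) → Eucl d
  norm_normal : ∀ F ∈ faces, ‖normal F‖ = 1
  face_nonempty : ∀ F ∈ faces, F.Nonempty
  /-- A face is a relatively open subset of a hyperplane orthogonal to its normal. -/
  face_planar : ∀ F ∈ faces, ∃ (U : Set (Eucl d)) (c : ℝ), IsOpen U ∧
    F = U ∩ {x | inner ℝ (normal F) x = c}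
  /-- The relative boundary of a face has zero `(d-1)`-dimensional measure. -/
  face_boundary_null : ∀ F ∈ faces,
    Measure.euclideanHausdorffMeasure (d - 1) (closure F \ F) = 0
  face_disjoint : ∀ F ∈ faces, ∀ G ∈ faces, F ≠ G → Disjoint F G
  frontier_eq : frontier carrier = ⋃ F ∈ faces, closure F
  /-- At almost every point of a face, the normal points out of `T`, and `T` lies on the opposite
  side only. -/
  normal_outward : ∀ F ∈ faces,
    ∀ᵐ x ∂((Measure.euclideanHausdorffMeasure (d - 1) : Measure (Eucl d)).restrict F),
      ∃ ε > 0, ∀ t ∈ Ioo (0 : ℝ) ε,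
        x - t • normal F ∈ carrier ∧ x + t • normal F ∉ carrier

variable {d : ℕ}

/-- The surface measure, i.e. the `(d-1)`-dimensional Hausdorff measure, normalised so that it is
the Lebesgue measure on hyperplanes. -/
def surf (d : ℕ) : Measure (Eucl d) := Measure.euclideanHausdorffMeasure (d - 1)

/-! ### Derivatives and Sobolev spaces -/

/-- The classical partial derivative `∂_j f`. -/
def partialDeriv (j : Fin d) (f : Eucl d → ℝ) (x : Eucl d) : ℝ :=
  fderiv ℝ f x (EuclideanSpace.single j 1)

/-- The classical gradient `(∂_j z_i)_{i,j}` of a vector-valued function. -/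
def jacobian (z : Eucl d → Eucl d) (x : Eucl d) : Matrix (Fin d) (Fin d) ℝ :=
  Matrix.of fun i j => partialDeriv j (fun y => z y i) x

/-- `g` is a `j`-th weak partial derivative of `v` on `T`, tested against `C_c^∞(T)`. -/
def IsWeakPartial (T : Set (Eucl d)) (j : Fin d) (v g : Eucl d → ℝ) : Prop :=
  ∀ φ : Eucl d → ℝ, ContDiff ℝ ∞ φ → HasCompactSupport φ → tsupport φ ⊆ T →
    ∫ x in T, v x * partialDeriv j φ x = -∫ x in T, g x * φ x

/-- `v ∈ H¹(T; ℝ)`. -/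
def MemH1 (T : Set (Eucl d)) (v : Eucl d → ℝ) : Prop :=
  MemLp v 2 (volume.restrict T) ∧
    ∀ j, ∃ g, MemLp g 2 (volume.restrict T) ∧ IsWeakPartial T j v g

/-- `v ∈ H¹(T; ℝ^d)`. -/
def MemH1Vec (T : Set (Eucl d)) (v : Eucl d → Eucl d) : Prop :=
  ∀ i, MemH1 T fun x => v x i

open Classical in
/-- (A representative of) the weak partial derivative `∂_j v ∈ L²(T; ℝ)`; zero if there is none. -/
def weakPartial (T : Set (Eucl d)) (j : Fin d) (v : Eucl d → ℝ) : Eucl d → ℝ :=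
  if h : ∃ g, MemLp g 2 (volume.restrict T) ∧ IsWeakPartial T j v g then h.choose else 0

theorem weakPartial_spec {T : Set (Eucl d)} {v : Eucl d → ℝ} (hv : MemH1 T v) (j : Fin d) :
    MemLp (weakPartial T j v) 2 (volume.restrict T) ∧
      IsWeakPartial T j v (weakPartial T j v) := by
  unfold weakPartial
  rw [dif_pos (hv.2 j)]
  exact (hv.2 j).choose_spec

/-! ### Traces -/

/-- `a` is the boundary value at `x` of `v : T → ℝ`: the averages of `|v - a|` over `T ∩ B(x, r)`
tend to zero as `r → 0⁺`. -/
def IsTraceAt (T : Set (Eucl d)) (v : Eucl d → ℝ) (x : Eucl d) (a : ℝ) : Prop :=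
  Tendsto (fun r : ℝ => ⨍ y in T ∩ Metric.ball x r, |v y - a|) (𝓝[>] 0) (𝓝 0)

open Classical in
/-- The trace on `∂T` of a function on `T`, defined (almost everywhere) through its boundary
values; zero at the points where there is none.  It only depends on the class of `v` modulo equality
almost everywhere in `T`, and it is the restriction of `v` if `v` is continuous up to `∂T`. -/
def trace (T : Set (Eucl d)) (v : Eucl d → ℝ) (x : Eucl d) : ℝ :=
  if h : ∃ a, IsTraceAt T v x a then h.choose else 0

/-- The trace of a vector-valued function (component-wise). -/
def traceVec (T : Set (Eucl d)) (v : Eucl d → Eucl d) (x : Eucl d) : Eucl d :=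
  WithLp.toLp 2 fun i => trace T (fun y => v y i) x

/-! ### Projectors onto constants -/

/-- The `L²`-orthogonal projector onto constants on `X`: the mean value on `X`. -/
def lproj (μ : Measure (Eucl d)) (X : Set (Eucl d)) (v : Eucl d → ℝ) : ℝ :=
  ⨍ x in X, v x ∂μ

/-- The component-wise `L²`-orthogonal projector for vector-valued functions. -/
def lprojVec (μ : Measure (Eucl d)) (X : Set (Eucl d)) (v : Eucl d → Eucl d) : Eucl d :=
  WithLp.toLp 2 fun i => lproj μ X fun x => v x i

/-- The component-wise `L²`-orthogonal projector for tensor-valued functions. -/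
def lprojMat (μ : Measure (Eucl d)) (X : Set (Eucl d))
    (τ : Eucl d → Matrix (Fin d) (Fin d) ℝ) : Matrix (Fin d) (Fin d) ℝ :=
  Matrix.of fun i j => lproj μ X fun x => τ x i j

/-- The weak gradient `(∂_j v_i)_{i,j}` of a vector-valued function. -/
def weakJacobian (T : Set (Eucl d)) (v : Eucl d → Eucl d) (x : Eucl d) :
    Matrix (Fin d) (Fin d) ℝ :=
  Matrix.of fun i j => weakPartial T j (fun y => v y i) x

/-! ### Affine functions with prescribed gradient and mean value

The elements of `P¹(T)` are represented by affine maps on `ℝ^d`; since `T` is open and nonempty,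
such a map is determined by its restriction to `T`. -/

theorem partialDeriv_affine (p : Eucl d →ᵃ[ℝ] ℝ) (j : Fin d) (x : Eucl d) :
    partialDeriv j p x = p.linear (EuclideanSpace.single j 1) := by
  have h : HasFDerivAt (fun y => p y) (LinearMap.toContinuousLinearMap p.linear) x := by
    have h1 : (fun y => p y) = fun y => LinearMap.toContinuousLinearMap p.linear y + p 0 := by
      funext y
      have := congrFun (AffineMap.decomp p) y
      simpa using this
    rw [h1]
    exact (ContinuousLinearMap.hasFDerivAt _).add_const _
  unfold partialDeriv
  have := h.fderiv
  rw [this]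
  rfl

theorem existsUnique_affine (T : PolyhedralElement d) (g : Fin d → ℝ) (m : ℝ) :
    ∃! p : Eucl d →ᵃ[ℝ] ℝ, (∀ x ∈ T.carrier, ∀ j, partialDeriv j p x = g j) ∧
      lproj volume T.carrier p = m := by
  have hpos : volume T.carrier ≠ 0 :=
    (T.isOpen_carrier.measure_pos volume T.nonempty_carrier).ne'
  have hfin : volume T.carrier ≠ ⊤ := T.isBounded_carrier.measure_lt_top.ne
  have hmean : ∀ (p : Eucl d →ᵃ[ℝ] ℝ) (c : ℝ),
      lproj volume T.carrier (fun x => p x + c) = lproj volume T.carrier p + c := by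
    intro p c
    have hint : IntegrableOn (fun x => p x) T.carrier := by
      have hcont : Continuous p := p.continuous_of_finiteDimensional
      exact (hcont.continuousOn.integrableOn_compact
        T.isBounded_carrier.isCompact_closure).mono_set subset_closure
    have hc : IntegrableOn (fun _ : Eucl d => c) T.carrier := integrableOn_const hfin
    have h1 : (⨍ x in T.carrier, c) = c := setAverage_const hpos hfin c
    unfold lproj
    rw [setAverage_eq] at h1 ⊢
    rw [setAverage_eq, integral_add hint hc, smul_add, h1]
  let L : Eucl d →ₗ[ℝ] ℝ := ∑ j, g j • (EuclideanSpace.proj j : Eucl d →L[ℝ] ℝ).toLinearMap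
  have hL : ∀ j, L (EuclideanSpace.single j 1) = g j := by
    intro j
    simp [L, LinearMap.sum_apply]
  refine ⟨L.toAffineMap + AffineMap.const ℝ _ (m - lproj volume T.carrier L.toAffineMap),
    ⟨?_, ?_⟩, ?_⟩
  · intro x _ j
    rw [partialDeriv_affine]
    simp [hL]
  · have := hmean L.toAffineMap (m - lproj volume T.carrier L.toAffineMap)
    rw [add_sub_cancel] at this
    exact this
  · rintro p ⟨hp1, hp2⟩
    obtain ⟨x0, hx0⟩ := T.nonempty_carrier
    have hlin : p.linear = L := by
      refine (EuclideanSpace.basisFun (Fin d) ℝ).toBasis.ext fun j => ?_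
      have := hp1 x0 hx0 j
      rw [partialDeriv_affine] at this
      simpa [hL] using this
    have hdec : ∀ y, p y = L.toAffineMap y + p 0 := by
      intro y
      have := congrFun (AffineMap.decomp p) y
      simpa [hlin] using this
    have h2 : lproj volume T.carrier p = lproj volume T.carrier L.toAffineMap + p 0 := by
      rw [← hmean]
      exact congrArg _ (funext hdec)
    ext y
    rw [hdec y]
    simp only [AffineMap.coe_add, Pi.add_apply, AffineMap.const_apply]
    linarith

theorem existsUnique_affineVec (T : PolyhedralElement d) (G : Matrix (Fin d) (Fin d) ℝ)
    (m : Eucl d) :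
    ∃! p : Eucl d →ᵃ[ℝ] Eucl d, (∀ x ∈ T.carrier, jacobian p x = G) ∧
      lprojVec volume T.carrier p = m := by
  choose q hq huniq using fun i => existsUnique_affine T (G i) (m i)
  let e : (Fin d → ℝ) →ᵃ[ℝ] Eucl d := (WithLp.linearEquiv 2 ℝ (Fin d → ℝ)).symm.toAffineEquiv
  have he : ∀ x i, (e.comp (AffineMap.pi q)) x i = q i x := fun x i => rfl
  refine ⟨e.comp (AffineMap.pi q), ⟨?_, ?_⟩, ?_⟩
  · intro x hx
    ext i j
    exact (hq i).1 x hx j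
  · ext i
    exact (hq i).2
  · rintro p ⟨hp1, hp2⟩
    let c : Fin d → (Eucl d →ᵃ[ℝ] ℝ) := fun i =>
      ((EuclideanSpace.proj i : Eucl d →L[ℝ] ℝ).toLinearMap.toAffineMap).comp p
    have hc : ∀ i, c i = q i := by
      intro i
      refine huniq i (c i) ⟨fun x hx j => ?_, ?_⟩
      · exact congrFun (congrFun (hp1 x hx) i) j
      · exact congrArg (fun z : Eucl d => z i) hp2
    ext x i
    rw [he, ← hc]
    rfl

/-! ### The elliptic projector -/

/-- The elliptic projector `H¹(T; ℝ) → P¹(T; ℝ)`: its gradient is the projection onto constants of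
the gradient, and it preserves the mean value. -/
def ellipticProj (T : PolyhedralElement d) (v : Eucl d → ℝ) : Eucl d →ᵃ[ℝ] ℝ :=
  (existsUnique_affine T (fun j => lproj volume T.carrier (weakPartial T.carrier j v))
    (lproj volume T.carrier v)).choose

theorem ellipticProj_spec (T : PolyhedralElement d) (v : Eucl d → ℝ) :
    (∀ x ∈ T.carrier, ∀ j, partialDeriv j (ellipticProj T v) x =
      lproj volume T.carrier (weakPartial T.carrier j v)) ∧
    lproj volume T.carrier (ellipticProj T v) = lproj volume T.carrier v :=
  (existsUnique_affine T (fun j => lproj volume T.carrier (weakPartial T.carrier j v))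
    (lproj volume T.carrier v)).choose_spec.1

/-- The vector version of the elliptic projector (component-wise). -/
def ellipticProjVec (T : PolyhedralElement d) (v : Eucl d → Eucl d) (x : Eucl d) : Eucl d :=
  WithLp.toLp 2 fun i => ellipticProj T (fun y => v y i) x

/-! ### Discrete unknowns, interpolation, and displacement reconstruction -/

/-- The local space of discrete unknowns: one constant vector for the element and one constant
vector for each face. -/
structure Unknowns (T : PolyhedralElement d) where
  cell : Eucl d
  face : T.faces → Eucl d

/-- The local interpolator `H¹(T; ℝ^d) → U_T`. -/
def interpolate (T : PolyhedralElement d) (v : Eucl d → Eucl d) : Unknowns T where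
  cell := lprojVec volume T.carrier v
  face := fun F => lprojVec (surf d) F.1 (traceVec T.carrier v)

/-- The gradient prescribed for the displacement reconstruction:
`∑_F |F|/|T| (v_F - v_T) ⊗ n_{TF}`. -/
def reconstructionGrad (T : PolyhedralElement d) (u : Unknowns T) : Matrix (Fin d) (Fin d) ℝ :=
  ∑ F : T.faces, ((surf d).real F.1 / volume.real T.carrier) •
    Matrix.of fun i j => (u.face F - u.cell) i * T.normal F.1 j

/-- The displacement reconstruction `U_T → P¹(T; ℝ^d)`: the unique affine map with the prescribed
gradient whose mean value on `T` is the element unknown. -/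
def reconstruction (T : PolyhedralElement d) (u : Unknowns T) : Eucl d →ᵃ[ℝ] Eucl d :=
  (existsUnique_affineVec T (reconstructionGrad T u) u.cell).choose

theorem reconstruction_spec (T : PolyhedralElement d) (u : Unknowns T) :
    (∀ x ∈ T.carrier, jacobian (reconstruction T u) x = reconstructionGrad T u) ∧
      lprojVec volume T.carrier (reconstruction T u) = u.cell :=
  (existsUnique_affineVec T (reconstructionGrad T u) u.cell).choose_spec.1

end HHO

end

/-! Everything rests on the divergence theorem for `H¹` functions on `T`: the integral of the weak
derivative ∂_j v equals the sum over the faces of n_j times the integral of the trace of v. For the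
constant 1 it says that the vectors |F| n_F sum to zero (`sum_normal_mul_area`), so the element
unknown drops out of the reconstructed gradient; applied to the components of v it identifies the
remaining face terms with the mean of the weak gradient (`reconstructionGrad_interpolate`). The
second identity follows, because an affine function is determined by its gradient and its mean.

The divergence theorem (`PolyhedralElement.integral_weakDeriv`) is obtained from difference
quotients, with no density of smooth functions and no regularity of the boundary beyond the flat
faces. Let g be the weak derivative of v in a direction e. For almost every x whose segment [x, x +
τe] stays in `T`, the increment of v along it is the integral of g (`ae_translate`). Integrate over
these x, divide by τ and let τ → 0. The side with g tends to the integral of g over `T`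
(`tendsto_integral_segSet`). On the other side everything cancels except the integrals of v over the
points that leave `T` within length τ along e, minus those that do so along -e
(`integral_segSet_increment`). Almost every exit along e is through a face with n·e > 0
(`ae_mem_layer`), and the rescaled integral over the corresponding layer tends to n·e times the
integral of the trace (`tendsto_integral_layer`).

Two facts on the trace are needed. At almost every flat boundary point, the trace defined by
averages over balls is also the limit of v along lines, in any given direction entering `T`
(`ae_hasLineLimit_trace`); this is a Lebesgue point argument on the hyperplane of the face. Moreover
the trace is integrable on each face (`integrableOn_trace`): the hyperplanes of the faces cut `T`
into convex cells, and near a point of a closed cell one direction gives lines of uniform length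
inside that cell. -/

noncomputable section

namespace HHO

variable {d : ℕ}

/-! ### Surface measure on hyperplanes and oblique Fubini formulas -/

/-- The hyperplane with normal `n` and offset `c`. -/
def hyperplane (n : Eucl d) (c : ℝ) : Set (Eucl d) := {x | inner ℝ n x = c}

/-- The surface measure on a hyperplane, as a measure on the whole space. -/
def hyperMeasure (n : Eucl d) (c : ℝ) : Measure (Eucl d) := (surf d).restrict (hyperplane n c)

theorem isClosed_hyperplane (n : Eucl d) (c : ℝ) : IsClosed (hyperplane n c) :=
  isClosed_eq (by fun_prop) continuous_const

theorem measurableSet_hyperplane (n : Eucl d) (c : ℝ) : MeasurableSet (hyperplane n c) :=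
  (isClosed_hyperplane n c).measurableSet

theorem finrank_orthogonal_normal {n : Eucl d} (hn : ‖n‖ = 1) :
    Module.finrank ℝ (ℝ ∙ n)ᗮ = d - 1 := by
  have hn0 : n ≠ 0 := by rintro rfl; simp at hn
  have h1 := Submodule.finrank_add_finrank_orthogonal (ℝ ∙ n)
  rw [finrank_span_singleton hn0, finrank_euclideanSpace_fin] at h1
  omega

/-- Normalised Hausdorff measure is transported by isometries and is Lebesgue measure on an inner
product space of matching dimension. Facts on Haar measure (balls, proper subspaces) thereby pass to
hyperplanes. -/
theorem hyperMeasure_eq_map {n y : Eucl d} {c : ℝ} (hn : ‖n‖ = 1) (hy : y ∈ hyperplane n c) :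
    hyperMeasure n c = Measure.map (fun w : (ℝ ∙ n)ᗮ => y + (w : Eucl d)) volume := by
  have hiso : Isometry fun w : (ℝ ∙ n)ᗮ => y + (w : Eucl d) :=
    (isometry_add_left y).comp isometry_subtype_coe
  have h := hiso.map_euclideanHausdorffMeasure (d := d - 1)
  have hvol : (Measure.euclideanHausdorffMeasure (d - 1) : Measure (ℝ ∙ n)ᗮ) = volume := by
    rw [← finrank_orthogonal_normal hn, InnerProductSpace.euclideanHausdorffMeasure_eq_volume]
  rw [hvol] at h
  rw [h, hyperMeasure, surf]
  congr 1
  ext x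
  simp only [hyperplane, mem_ofPred_eq, mem_range, Subtype.exists,
    Submodule.mem_orthogonal_singleton_iff_inner_right] at hy ⊢
  constructor
  · intro hx
    exact ⟨x - y, by rw [inner_sub_right, hx, hy, sub_self], by simp⟩
  · rintro ⟨w, hw, rfl⟩
    rw [inner_add_right, hw, hy, add_zero]

theorem smul_mem_hyperplane {n : Eucl d} (hn : ‖n‖ = 1) (c : ℝ) : c • n ∈ hyperplane n c := by
  simp [hyperplane, inner_smul_right, hn]

theorem hyperMeasure_closedBall {n y : Eucl d} {c : ℝ} (hn : ‖n‖ = 1) (hy : y ∈ hyperplane n c)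
    {r : ℝ} (hr : 0 ≤ r) :
    hyperMeasure n c (Metric.closedBall y r) =
      ENNReal.ofReal (r ^ (d - 1)) * volume (Metric.ball (0 : (ℝ ∙ n)ᗮ) 1) := by
  rw [hyperMeasure_eq_map hn hy, Measure.map_apply (by fun_prop) measurableSet_closedBall,
    ← finrank_orthogonal_normal hn, ← Measure.addHaar_closedBall _ 0 hr]
  congr 1
  ext w
  simp

theorem isLocallyFiniteMeasure_hyper {n : Eucl d} (hn : ‖n‖ = 1) (c : ℝ) :
    IsLocallyFiniteMeasure (hyperMeasure n c) := by
  have hfin : ∀ R : ℝ, hyperMeasure n c (Metric.closedBall (c • n) R) < ⊤ := by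
    intro R
    refine (measure_mono (Metric.closedBall_subset_closedBall (le_max_left R 0))).trans_lt ?_
    rw [hyperMeasure_closedBall hn (smul_mem_hyperplane hn c) (le_max_right _ _)]
    exact ENNReal.mul_lt_top ENNReal.ofReal_lt_top measure_ball_lt_top
  refine ⟨fun x => ⟨Metric.closedBall (c • n) (dist x (c • n) + 1), ?_, hfin _⟩⟩
  exact Metric.closedBall_mem_nhds_of_mem (by simp)

theorem ae_mem_hyperplane (n : Eucl d) (c : ℝ) : ∀ᵐ x ∂(hyperMeasure n c), x ∈ hyperplane n c :=
  ae_restrict_mem (measurableSet_hyperplane n c)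

theorem volume_hyperplane {n : Eucl d} (hn : ‖n‖ = 1) (c : ℝ) : volume (hyperplane n c) = 0 := by
  have hn0 : n ≠ 0 := by rintro rfl; simp at hn
  have : hyperplane n c = (AffineSubspace.mk' (c • n) (ℝ ∙ n)ᗮ : Set (Eucl d)) := by
    ext x
    simp only [SetLike.mem_coe, AffineSubspace.mem_mk', vsub_eq_sub,
      Submodule.mem_orthogonal_singleton_iff_inner_right, hyperplane, mem_ofPred_eq,
      inner_sub_right, inner_smul_right, real_inner_self_eq_norm_sq, hn]
    constructor <;> intro h <;> linarith
  rw [this]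
  refine Measure.addHaar_affineSubspace _ _ fun h => ?_
  have h1 : (ℝ ∙ n)ᗮ = ⊤ := by
    have := congrArg AffineSubspace.direction h
    simpa using this
  have : n ∈ (ℝ ∙ n)ᗮ := h1 ▸ Submodule.mem_top
  rw [Submodule.mem_orthogonal_singleton_iff_inner_right] at this
  simp at this
  exact hn0 this

/-- The intersection of two distinct hyperplanes is null for the surface measure. -/
theorem hyperMeasure_hyperplane {n m y : Eucl d} {c b : ℝ} (hn : ‖n‖ = 1)
    (hy : y ∈ hyperplane n c) (hyb : y ∉ hyperplane m b) :
    hyperMeasure n c (hyperplane m b) = 0 := by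
  by_cases hne : (hyperplane n c ∩ hyperplane m b).Nonempty
  swap
  · rw [hyperMeasure, Measure.restrict_apply (measurableSet_hyperplane m b), inter_comm,
      not_nonempty_iff_eq_empty.1 hne, measure_empty]
  obtain ⟨z, hz, hzb⟩ := hne
  rw [hyperMeasure_eq_map hn hz, Measure.map_apply (by fun_prop) (measurableSet_hyperplane m b)]
  let ℓ : (ℝ ∙ n)ᗮ →ₗ[ℝ] ℝ := (innerₛₗ ℝ m).comp (ℝ ∙ n)ᗮ.subtype
  have : (fun w : (ℝ ∙ n)ᗮ => z + (w : Eucl d)) ⁻¹' hyperplane m b = (LinearMap.ker ℓ : Set _) := by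
    ext w
    simp only [hyperplane, mem_preimage, mem_ofPred_eq, inner_add_right, SetLike.mem_coe,
      LinearMap.mem_ker, LinearMap.comp_apply, ℓ, Submodule.subtype_apply, innerₛₗ_apply_apply] at hzb ⊢
    constructor <;> intro h <;> linarith
  rw [this]
  refine Measure.addHaar_submodule _ _ fun h => hyb ?_
  have hmem : y - z ∈ (ℝ ∙ n)ᗮ := by
    rw [Submodule.mem_orthogonal_singleton_iff_inner_right, inner_sub_right]
    simp only [hyperplane, mem_ofPred_eq] at hy hz
    rw [hy, hz, sub_self]
  have h2 : (⟨y - z, hmem⟩ : (ℝ ∙ n)ᗮ) ∈ LinearMap.ker ℓ := h ▸ Submodule.mem_top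
  simp only [LinearMap.mem_ker, LinearMap.comp_apply, ℓ, Submodule.subtype_apply, innerₛₗ_apply_apply,
    inner_sub_right] at h2
  simp only [hyperplane, mem_ofPred_eq] at hzb ⊢
  linarith

/-- Cavalieri's principle for parallel slices; no Jacobian appears because `n` is a unit vector. -/
theorem volume_eq_lintegral_hyperMeasure {n : Eucl d} (hn : ‖n‖ = 1) {t : Set (Eucl d)}
    (ht : MeasurableSet t) : volume t = ∫⁻ x : ℝ, surf d (t ∩ hyperplane n x) := by
  have hn0 : n ≠ 0 := by rintro rfl; simp at hn
  have h := EuclideanGeometry.euclideanHausdorffMeasure_eq_lintegral (0 : Eucl d) hn0 ht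
  rw [InnerProductSpace.euclideanHausdorffMeasure_eq_volume, finrank_euclideanSpace_fin] at h
  rw [h, ← ofReal_norm, hn, ENNReal.ofReal_one, one_mul]
  refine lintegral_congr fun x => ?_
  rw [surf]
  congr 2
  ext z
  simp only [SetLike.mem_coe, AffineSubspace.mem_mk', vsub_eq_sub, vadd_eq_add, add_zero,
      Submodule.mem_orthogonal_singleton_iff_inner_right, hyperplane, mem_ofPred_eq,
      inner_sub_right, inner_smul_right, real_inner_self_eq_norm_sq, hn]
  constructor <;> intro h <;> linarith

/-- Coordinates along the direction `e` based on a hyperplane transversal to `e`. -/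
theorem map_hyperMeasure_prod {n e : Eucl d} {c : ℝ} (hn : ‖n‖ = 1) (he : inner ℝ n e ≠ 0) :
    ((hyperMeasure n c).prod volume).map (fun p : Eucl d × ℝ => p.1 + p.2 • e) =
      ENNReal.ofReal |(inner ℝ n e)⁻¹| • volume := by
  have := isLocallyFiniteMeasure_hyper hn c
  have hm : Measurable fun p : Eucl d × ℝ => p.1 + p.2 • e := by fun_prop
  ext t ht
  rw [Measure.map_apply hm ht, Measure.prod_apply_symm (hm ht), Measure.smul_apply, smul_eq_mul,
    volume_eq_lintegral_hyperMeasure hn ht]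
  -- Translation by s e carries the base hyperplane to the parallel one with offset ⟨n, e⟩ s + c.
  -- The affine change of variable in s then produces the Jacobian.
  have h1 : ∀ s : ℝ, hyperMeasure n c
      ((fun x => (x, s)) ⁻¹' ((fun p : Eucl d × ℝ => p.1 + p.2 • e) ⁻¹' t)) =
      surf d (t ∩ hyperplane n (inner ℝ n e * s + c)) := by
    intro s
    have hms : MeasurableSet
        ((fun x => (x, s)) ⁻¹' ((fun p : Eucl d × ℝ => p.1 + p.2 • e) ⁻¹' t)) :=
      (measurable_id.prodMk measurable_const) (hm ht)
    rw [hyperMeasure, Measure.restrict_apply hms, surf,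
      ← measure_preimage_add (Measure.euclideanHausdorffMeasure (d - 1)) (s • e)
        (t ∩ hyperplane n (inner ℝ n e * s + c))]
    congr 1
    ext x
    simp only [mem_inter_iff, mem_preimage, hyperplane, mem_ofPred_eq, inner_add_right,
      inner_smul_right, add_comm (s • e) x]
    refine and_congr_right fun _ => ?_
    constructor <;> intro h <;> linarith
  simp_rw [h1]
  have hg : AEMeasurable (fun x => surf d (t ∩ hyperplane n x))
      (Measure.map (fun s : ℝ => inner ℝ n e * s + c) volume) := by
    have hmeas : Measurable fun s : ℝ => surf d (t ∩ hyperplane n (inner ℝ n e * s + c)) := by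
      simp_rw [← h1]
      exact measurable_measure_prodMk_right (hm ht)
    have : (fun x => surf d (t ∩ hyperplane n x)) =
        (fun s : ℝ => surf d (t ∩ hyperplane n (inner ℝ n e * s + c))) ∘
          fun x => (inner ℝ n e)⁻¹ * (x - c) := by
      funext x
      simp only [Function.comp]
      rw [mul_inv_cancel_left₀ he, sub_add_cancel]
    rw [this]
    exact (hmeas.comp (by fun_prop)).aemeasurable
  have hmap : Measure.map (fun s : ℝ => inner ℝ n e * s + c) volume =
      ENNReal.ofReal |(inner ℝ n e)⁻¹| • volume := by
    have : (fun s : ℝ => inner ℝ n e * s + c) = (fun x => x + c) ∘ fun s => inner ℝ n e * s := rfl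
    rw [this, ← Measure.map_map (by fun_prop) (by fun_prop), Real.map_volume_mul_left he,
      Measure.map_smul, map_add_right_eq_self]
  rw [← lintegral_map' (f := fun x => surf d (t ∩ hyperplane n x)) hg (by fun_prop), hmap,
    lintegral_smul_measure, smul_eq_mul]

theorem quasiMeasurePreserving_hyper {n e : Eucl d} {c : ℝ} (hn : ‖n‖ = 1)
    (he : inner ℝ n e ≠ 0) :
    Measure.QuasiMeasurePreserving (fun p : Eucl d × ℝ => p.1 + p.2 • e)
      ((hyperMeasure n c).prod volume) volume := by
  refine ⟨by fun_prop, ?_⟩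
  rw [map_hyperMeasure_prod hn he]
  exact Measure.smul_absolutelyContinuous

theorem ae_hyper_of_ae {n e : Eucl d} {c : ℝ} (hn : ‖n‖ = 1) (he : inner ℝ n e ≠ 0)
    {p : Eucl d → Prop} (hp : ∀ᵐ x, p x) :
    ∀ᵐ y ∂(hyperMeasure n c), ∀ᵐ s : ℝ, p (y + s • e) := by
  have := isLocallyFiniteMeasure_hyper hn c
  exact Measure.ae_ae_of_ae_prod ((quasiMeasurePreserving_hyper hn he).ae hp)

theorem integrable_hyper_prod {n e : Eucl d} {c : ℝ} (hn : ‖n‖ = 1) (he : inner ℝ n e ≠ 0)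
    {f : Eucl d → ℝ} (hf : Integrable f) :
    Integrable (fun p : Eucl d × ℝ => f (p.1 + p.2 • e)) ((hyperMeasure n c).prod volume) := by
  have hf' : Integrable f (((hyperMeasure n c).prod volume).map
      (fun p : Eucl d × ℝ => p.1 + p.2 • e)) := by
    rw [map_hyperMeasure_prod hn he]
    exact hf.smul_measure ENNReal.ofReal_ne_top
  exact hf'.comp_measurable (by fun_prop)

theorem integral_eq_hyper {n e : Eucl d} {c : ℝ} (hn : ‖n‖ = 1) (he : inner ℝ n e ≠ 0)
    {f : Eucl d → ℝ} (hf : Integrable f) :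
    ∫ x, f x = |inner ℝ n e| * ∫ y, (∫ s : ℝ, f (y + s • e)) ∂(hyperMeasure n c) := by
  have := isLocallyFiniteMeasure_hyper hn c
  have h1 := integral_map (μ := (hyperMeasure n c).prod volume)
    (φ := fun p : Eucl d × ℝ => p.1 + p.2 • e) (f := f) (by fun_prop) (by
      rw [map_hyperMeasure_prod hn he]
      exact (hf.smul_measure ENNReal.ofReal_ne_top).1)
  rw [map_hyperMeasure_prod hn he, integral_smul_measure,
    integral_prod _ (integrable_hyper_prod hn he hf), ENNReal.toReal_ofReal (abs_nonneg _),
    smul_eq_mul, abs_inv] at h1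
  rw [← h1, mul_inv_cancel_left₀ (abs_ne_zero.2 he)]

/-! ### Fundamental theorem of calculus along segments -/

/-- `g` is a weak derivative of `v` on `T` in the direction `e`. -/
def IsWeakDeriv (T : Set (Eucl d)) (e : Eucl d) (v g : Eucl d → ℝ) : Prop :=
  ∀ φ : Eucl d → ℝ, ContDiff ℝ ∞ φ → HasCompactSupport φ → tsupport φ ⊆ T →
    ∫ x, v x * fderiv ℝ φ x e = -∫ x, g x * φ x

/-- The points from which the segment with direction `τ e` stays in `T`. -/
def segSet (T : Set (Eucl d)) (e : Eucl d) (τ : ℝ) : Set (Eucl d) :=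
  {x | ∀ t ∈ Icc 0 τ, x + t • e ∈ T}

theorem isOpen_segSet {T : Set (Eucl d)} (hT : IsOpen T) (e : Eucl d) (τ : ℝ) :
    IsOpen (segSet T e τ) := by
  rw [isOpen_iff_mem_nhds]
  intro x hx
  refine isCompact_Icc.eventually_forall_of_forall_eventually fun t ht => ?_
  have : Continuous fun z : Eucl d × ℝ => z.1 + z.2 • e := by fun_prop
  exact this.continuousAt.eventually_mem (hT.mem_nhds (hx t ht))

theorem segSet_subset (T : Set (Eucl d)) (e : Eucl d) {τ : ℝ} (hτ : 0 ≤ τ) :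
    segSet T e τ ⊆ T := fun x hx => by simpa using hx 0 ⟨le_rfl, hτ⟩

theorem integrable_shift_prod {g : Eucl d → ℝ} (hg : Integrable g) (hgm : Measurable g)
    (e : Eucl d) (τ : ℝ) :
    Integrable (fun p : Eucl d × ℝ => g (p.1 + p.2 • e))
      ((volume : Measure (Eucl d)).prod (volume.restrict (Ioc 0 τ))) := by
  have hm : AEStronglyMeasurable (fun p : Eucl d × ℝ => g (p.1 + p.2 • e))
      ((volume : Measure (Eucl d)).prod (volume.restrict (Ioc 0 τ))) :=
    (hgm.comp (by fun_prop)).aestronglyMeasurable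
  rw [integrable_prod_iff' hm]
  refine ⟨Eventually.of_forall fun t => hg.comp_add_right (t • e), ?_⟩
  have : ∀ t : ℝ, ∫ x, ‖g (x + t • e)‖ = ∫ x, ‖g x‖ := fun t =>
    integral_add_right_eq_self (fun x => ‖g x‖) (t • e)
  simp_rw [this]
  exact integrable_const _

/-- The pairing of v with the translate φ(· - te) is differentiable in t, since the derivative falls
on φ; the weak derivative turns it into a pairing with g. Integrating in t from 0 to τ and applying
Fubini gives the claim. -/
theorem integral_translate_test {T : Set (Eucl d)} {e : Eucl d} {v g : Eucl d → ℝ}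
    (hv : Integrable v) (hg : Integrable g) (hgm : Measurable g)
    (h : IsWeakDeriv T e v g) {τ : ℝ} (hτ : 0 ≤ τ) {φ : Eucl d → ℝ} (hφ : ContDiff ℝ ∞ φ)
    (hc : HasCompactSupport φ) (hs : tsupport φ ⊆ segSet T e τ) :
    ∫ x, φ x * (v (x + τ • e) - v x - ∫ t in (0 : ℝ)..τ, g (x + t • e)) = 0 := by
  have hφc : Continuous φ := hφ.continuous
  have hdc : Continuous fun x => fderiv ℝ φ x e :=
    (hφ.continuous_fderiv (by simp)).clm_apply continuous_const
  have hdcs : HasCompactSupport fun x => fderiv ℝ φ x e :=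
    (hc.fderiv (𝕜 := ℝ)).comp_left (g := fun L : Eucl d →L[ℝ] ℝ => L e) rfl
  obtain ⟨C, hC⟩ := hφc.bounded_above_of_compact_support hc
  obtain ⟨C', hC'⟩ := hdc.bounded_above_of_compact_support hdcs
  let F : ℝ → ℝ := fun t => ∫ y, v y * φ (y - t • e)
  let F' : ℝ → ℝ := fun t => ∫ y, v y * -(fderiv ℝ φ (y - t • e) e)
  have hvm := hv.aestronglyMeasurable
  have hderiv : ∀ t, HasDerivAt F (F' t) t := by
    intro t
    refine (hasDerivAt_integral_of_dominated_loc_of_deriv_le (𝕜 := ℝ) (E := ℝ) (s := univ)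
      (F := fun t y => v y * φ (y - t • e))
      (F' := fun t y => v y * -(fderiv ℝ φ (y - t • e) e))
      (bound := fun y => ‖v y‖ * C') univ_mem ?_ ?_ ?_ ?_ ?_ ?_).2
    · exact Eventually.of_forall fun s =>
        hvm.mul (hφc.comp (by fun_prop)).aestronglyMeasurable
    · exact hv.mul_bdd (c := C) (hφc.comp (by fun_prop)).aestronglyMeasurable
        (Eventually.of_forall fun y => hC _)
    · exact hvm.mul (hdc.comp (by fun_prop)).neg.aestronglyMeasurable
    · refine Eventually.of_forall fun y s _ => ?_
      rw [norm_mul, norm_neg]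
      exact mul_le_mul_of_nonneg_left (hC' _) (norm_nonneg _)
    · exact hv.norm.mul_const C'
    · refine Eventually.of_forall fun y s _ => HasDerivAt.const_mul (v y) ?_
      have h1 : HasFDerivAt φ (fderiv ℝ φ (y - s • e)) (y - s • e) :=
        (hφ.differentiable (by simp) _).hasFDerivAt
      have h2 : HasDerivAt (fun s : ℝ => y - s • e) (-((1 : ℝ) • e)) s :=
        ((hasDerivAt_id s).smul_const e).const_sub y
      have := HasFDerivAt.comp_hasDerivAt s h1 h2
      rw [one_smul, map_neg] at this
      exact this
  have hF'c : Continuous F' := by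
    refine continuous_of_dominated (bound := fun y => ‖v y‖ * C') ?_ ?_ ?_ ?_
    · exact fun s => hvm.mul (hdc.comp (by fun_prop)).neg.aestronglyMeasurable
    · refine fun s => Eventually.of_forall fun y => ?_
      rw [norm_mul, norm_neg]
      exact mul_le_mul_of_nonneg_left (hC' _) (norm_nonneg _)
    · exact hv.norm.mul_const C'
    · exact Eventually.of_forall fun y => continuous_const.mul (hdc.comp (by fun_prop)).neg
  have hftc : ∫ t in (0 : ℝ)..τ, F' t = F τ - F 0 :=
    intervalIntegral.integral_eq_sub_of_hasDerivAt (fun t _ => hderiv t)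
      (hF'c.intervalIntegrable _ _)
  -- The support of φ lies in `segSet T e τ`, so for these t the translated test function is still
  -- supported in `T`.
  have hF'eq : ∀ t ∈ Icc 0 τ, F' t = ∫ x, g (x + t • e) * φ x := by
    intro t ht
    let ψ : Eucl d → ℝ := fun y => φ (y - t • e)
    have hψ : ContDiff ℝ ∞ ψ := hφ.comp (by fun_prop)
    have hψe : ψ = φ ∘ (Homeomorph.subRight (t • e)) := rfl
    have hψc : HasCompactSupport ψ := hc.comp_homeomorph (Homeomorph.subRight (t • e))
    have hψs : tsupport ψ ⊆ T := by
      rw [hψe, tsupport_comp_eq_preimage]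
      intro y hy
      have := hs hy t ht
      simpa using this
    have h1 := h ψ hψ hψc hψs
    have h2 : ∀ y, fderiv ℝ ψ y = fderiv ℝ φ (y - t • e) := fun y => by
      have := fderiv_comp_add_right (𝕜 := ℝ) (f := φ) (x := y) (-(t • e))
      simpa [ψ, sub_eq_add_neg] using this
    simp only [h2] at h1
    have h3 : F' t = -∫ y, v y * fderiv ℝ φ (y - t • e) e := by
      rw [← integral_neg]
      exact integral_congr_ae (Eventually.of_forall fun y => by simp)
    rw [h3, h1, neg_neg, ← integral_add_right_eq_self _ (t • e)]
    simp [ψ]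
  have hprod : Integrable (fun p : Eucl d × ℝ => g (p.1 + p.2 • e) * φ p.1)
      ((volume : Measure (Eucl d)).prod (volume.restrict (Ioc 0 τ))) :=
    (integrable_shift_prod hg hgm e τ).mul_bdd (c := C)
      (hφc.comp continuous_fst).aestronglyMeasurable (Eventually.of_forall fun p => hC _)
  have hswap : ∫ t in (0 : ℝ)..τ, F' t = ∫ x, (∫ t in (0 : ℝ)..τ, g (x + t • e)) * φ x := by
    rw [intervalIntegral.integral_of_le hτ]
    simp_rw [intervalIntegral.integral_of_le hτ, ← integral_mul_const]
    rw [integral_integral_swap (f := fun x t => g (x + t • e) * φ x) hprod]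
    exact setIntegral_congr_fun measurableSet_Ioc fun t ht => hF'eq t ⟨ht.1.le, ht.2⟩
  have hFτ : F τ = ∫ x, v (x + τ • e) * φ x := by
    have := integral_add_right_eq_self (μ := volume) (fun y => v y * φ (y - τ • e)) (τ • e)
    simp only [add_sub_cancel_right] at this
    exact this.symm
  have hF0 : F 0 = ∫ x, v x * φ x := by simp [F]
  have hi1 : Integrable fun x => v (x + τ • e) * φ x :=
    (hv.comp_add_right (τ • e)).mul_bdd (c := C) hφc.aestronglyMeasurable
      (Eventually.of_forall hC)
  have hi2 : Integrable fun x => v x * φ x :=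
    hv.mul_bdd (c := C) hφc.aestronglyMeasurable (Eventually.of_forall hC)
  have hi3 : Integrable fun x => (∫ t in (0 : ℝ)..τ, g (x + t • e)) * φ x := by
    simp_rw [intervalIntegral.integral_of_le hτ, ← integral_mul_const]
    exact hprod.integral_prod_left
  have : ∀ x, φ x * (v (x + τ • e) - v x - ∫ t in (0 : ℝ)..τ, g (x + t • e)) =
      v (x + τ • e) * φ x - v x * φ x - (∫ t in (0 : ℝ)..τ, g (x + t • e)) * φ x := by
    intro x; ring
  simp_rw [this]
  rw [integral_sub (f := fun x => v (x + τ • e) * φ x - v x * φ x) (hi1.sub hi2) hi3,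
    integral_sub hi1 hi2, ← hFτ, ← hF0, ← hswap, hftc, sub_self]

/-- A function with an integrable weak derivative satisfies the fundamental theorem of calculus
along almost every segment of given direction and length. -/
theorem ae_translate {T : Set (Eucl d)} (hT : IsOpen T) {e : Eucl d} {v g : Eucl d → ℝ}
    (hv : Integrable v) (hg : Integrable g) (hgm : Measurable g)
    (h : IsWeakDeriv T e v g) {τ : ℝ} (hτ : 0 ≤ τ) :
    ∀ᵐ x, x ∈ segSet T e τ → v (x + τ • e) = v x + ∫ t in (0 : ℝ)..τ, g (x + t • e) := by
  have hint : Integrable fun x => v (x + τ • e) - v x - ∫ t in (0 : ℝ)..τ, g (x + t • e) := by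
    refine ((hv.comp_add_right (τ • e)).sub hv).sub ?_
    simp_rw [intervalIntegral.integral_of_le hτ]
    exact (integrable_shift_prod hg hgm e τ).integral_prod_left
  have := (isOpen_segSet hT e τ).ae_eq_zero_of_integral_contDiff_smul_eq_zero
    (hint.locallyIntegrable.locallyIntegrableOn _)
    fun φ hφ hc hs => integral_translate_test hv hg hgm h hτ hφ hc hs
  filter_upwards [this] with x hx hxs
  linarith [hx hxs]

theorem measurable_intervalIntegral_shift {g : Eucl d → ℝ} (hgm : Measurable g) (e : Eucl d) :
    Measurable fun p : Eucl d × ℝ => ∫ t in (0 : ℝ)..p.2, g (p.1 + t • e) := by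
  have hset : MeasurableSet {q : (Eucl d × ℝ) × ℝ | q.2 ∈ Ioc 0 q.1.2} :=
    (measurableSet_lt measurable_const measurable_snd).inter
      (measurableSet_le measurable_snd measurable_fst.snd)
  have hset' : MeasurableSet {q : (Eucl d × ℝ) × ℝ | q.2 ∈ Ioc q.1.2 0} :=
    (measurableSet_lt measurable_fst.snd measurable_snd).inter
      (measurableSet_le measurable_snd measurable_const)
  have hg' : Measurable fun q : (Eucl d × ℝ) × ℝ => g (q.1.1 + q.2 • e) :=
    hgm.comp (by fun_prop)
  have h1 := ((hg'.indicator hset).stronglyMeasurable.integral_prod_right'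
    (ν := (volume : Measure ℝ))).measurable
  have h2 := ((hg'.indicator hset').stronglyMeasurable.integral_prod_right'
    (ν := (volume : Measure ℝ))).measurable
  convert h1.sub h2 using 1
  funext p
  rw [intervalIntegral, Pi.sub_apply, ← integral_indicator measurableSet_Ioc,
    ← integral_indicator measurableSet_Ioc]
  rfl

/-- The version of `ae_translate` for almost every point and almost every length. -/
theorem ae_ae_translate {T : Set (Eucl d)} (hT : IsOpen T) {e : Eucl d} {v g : Eucl d → ℝ}
    (hv : Integrable v) (hvm : Measurable v) (hg : Integrable g) (hgm : Measurable g)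
    (h : IsWeakDeriv T e v g) :
    ∀ᵐ x, ∀ᵐ τ : ℝ, 0 ≤ τ → x ∈ segSet T e τ →
      v (x + τ • e) = v x + ∫ t in (0 : ℝ)..τ, g (x + t • e) := by
  let E : Set (ℝ × Eucl d) := {p | 0 ≤ p.1 ∧ p.2 ∈ segSet T e p.1 ∧
    v (p.2 + p.1 • e) ≠ v p.2 + ∫ t in (0 : ℝ)..p.1, g (p.2 + t • e)}
  have hseg : MeasurableSet {p : ℝ × Eucl d | 0 ≤ p.1 ∧ p.2 ∈ segSet T e p.1} := by
    -- Rescaling the segment to the fixed compact interval [0, 1] turns the second condition into an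
    -- open one in p.
    have : {p : ℝ × Eucl d | 0 ≤ p.1 ∧ p.2 ∈ segSet T e p.1} =
        {p | 0 ≤ p.1} ∩ {p | ∀ θ ∈ Icc (0 : ℝ) 1, p.2 + (θ * p.1) • e ∈ T} := by
      ext p
      simp only [mem_ofPred_eq, mem_inter_iff, segSet]
      refine and_congr_right fun hp => ⟨fun H θ hθ => H _ ⟨by positivity [hθ.1], ?_⟩,
        fun H t ht => ?_⟩
      · exact mul_le_of_le_one_left hp hθ.2
      · rcases hp.eq_or_lt with h0 | h0
        · have h1 : t = 0 := le_antisymm (h0 ▸ ht.2) ht.1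
          simpa [h1] using H 0 ⟨le_rfl, zero_le_one⟩
        · have := H (t / p.1) ⟨div_nonneg ht.1 hp, (div_le_one h0).2 ht.2⟩
          rwa [div_mul_cancel₀ _ h0.ne'] at this
    rw [this]
    refine (measurableSet_le measurable_const measurable_fst).inter (IsOpen.measurableSet ?_)
    rw [isOpen_iff_mem_nhds]
    intro p hp
    refine isCompact_Icc.eventually_forall_of_forall_eventually fun t ht => ?_
    have : Continuous fun z : (ℝ × Eucl d) × ℝ => z.1.2 + (z.2 * z.1.1) • e := by fun_prop
    exact this.continuousAt.eventually_mem (hT.mem_nhds (hp t ht))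
  have hE : MeasurableSet E := by
    have h1 : Measurable fun p : ℝ × Eucl d => v (p.2 + p.1 • e) := hvm.comp (by fun_prop)
    have h2 : Measurable fun p : ℝ × Eucl d => v p.2 + ∫ t in (0 : ℝ)..p.1, g (p.2 + t • e) :=
      (hvm.comp measurable_snd).add ((measurable_intervalIntegral_shift hgm e).comp measurable_swap)
    have : E = {p : ℝ × Eucl d | 0 ≤ p.1 ∧ p.2 ∈ segSet T e p.1} ∩
        {p | v (p.2 + p.1 • e) = v p.2 + ∫ t in (0 : ℝ)..p.1, g (p.2 + t • e)}ᶜ := by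
      ext p
      simp [E, and_assoc]
    rw [this]
    exact hseg.inter (measurableSet_eq_fun h1 h2).compl
  -- Each slice at fixed τ is null by `ae_translate`; Fubini then permits exchanging the roles of x
  -- and τ.
  have hE0 : ((volume : Measure ℝ).prod (volume : Measure (Eucl d))) E = 0 := by
    rw [Measure.measure_prod_null hE]
    refine Eventually.of_forall fun τ => ?_
    by_cases hτ : 0 ≤ τ
    · refine measure_mono_null (fun x hx => ?_) (ae_translate hT hv hg hgm h hτ)
      exact fun H => hx.2.2 (H hx.2.1)
    · have : Prod.mk τ ⁻¹' E = ∅ := by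
        ext x
        simp [E, hτ]
      simp [this]
  have hswap : ((volume : Measure (Eucl d)).prod (volume : Measure ℝ)) (Prod.swap ⁻¹' E) = 0 :=
    Measure.measurePreserving_swap.quasiMeasurePreserving.preimage_null hE0
  have h3 := Measure.ae_ae_of_ae_prod (measure_eq_zero_iff_ae_notMem.1 hswap)
  filter_upwards [h3] with x hx
  filter_upwards [hx] with τ hτ h0 hs
  by_contra hne
  exact hτ ⟨h0, hs, hne⟩

/-! ### Boundary values along transversal lines -/

/-- On the half line starting at `y` with direction `e`, up to length `δ`, the function `v` is a
primitive of `g` with initial value `a`. -/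
def HasLineLimit (v g : Eucl d → ℝ) (e y : Eucl d) (δ a : ℝ) : Prop :=
  ∀ᵐ s : ℝ, s ∈ Ioo 0 δ → v (y + s • e) = a + ∫ t in (0 : ℝ)..s, g (y + t • e)

theorem exists_mem_Ioo_of_ae {p : ℝ → Prop} (hp : ∀ᵐ s : ℝ, p s) {a b : ℝ} (hab : a < b) :
    ∃ s ∈ Ioo a b, p s := by
  by_contra! H
  have : volume (Ioo a b) = 0 := measure_mono_null (fun s hs => H s hs) hp
  simp at this
  linarith

theorem HasLineLimit.mono {v g : Eucl d → ℝ} {e y : Eucl d} {δ δ' a : ℝ}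
    (h : HasLineLimit v g e y δ a) (hle : δ' ≤ δ) : HasLineLimit v g e y δ' a := by
  filter_upwards [h] with s hs hs'
  exact hs ⟨hs'.1, hs'.2.trans_le hle⟩

theorem HasLineLimit.unique {v g : Eucl d → ℝ} {e y : Eucl d} {δ δ' a b : ℝ} (hδ : 0 < δ)
    (hδ' : 0 < δ') (h : HasLineLimit v g e y δ a) (h' : HasLineLimit v g e y δ' b) : a = b := by
  obtain ⟨s, hs, h1, h2⟩ := exists_mem_Ioo_of_ae (h.and h') (lt_min hδ hδ')
  have h3 := h1 ⟨hs.1, hs.2.trans_le (min_le_left _ _)⟩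
  have h4 := h2 ⟨hs.1, hs.2.trans_le (min_le_right _ _)⟩
  linarith

/-- Fix a good s₁. Points to its right are compared with it directly; a good point to its left is
compared with it through a common point r to the right of both. -/
theorem ae_const_of_ae_ae {u : ℝ → ℝ} {δ : ℝ} (hδ : 0 < δ)
    (h : ∀ᵐ s : ℝ, s ∈ Ioo 0 δ → ∀ᵐ s' : ℝ, s' ∈ Ioo s δ → u s' = u s) :
    ∃ c, ∀ᵐ s : ℝ, s ∈ Ioo 0 δ → u s = c := by
  obtain ⟨s₁, hs₁, h₁⟩ := exists_mem_Ioo_of_ae h hδ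
  refine ⟨u s₁, ?_⟩
  have h₂ := h₁ hs₁
  filter_upwards [h, h₂] with s hs hs' hmem
  rcases lt_or_ge s₁ s with hlt | hle
  · exact hs' ⟨hlt, hmem.2⟩
  · obtain ⟨r, hr, hr1, hr2⟩ := exists_mem_Ioo_of_ae ((hs hmem).and h₂) hs₁.2
    rw [← hr1 ⟨hle.trans_lt hr.1, hr.2⟩, hr2 hr]

theorem ae_integrable_line {n e : Eucl d} {c : ℝ} (hn : ‖n‖ = 1) (he : inner ℝ n e ≠ 0)
    {g : Eucl d → ℝ} (hg : Integrable g) :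
    ∀ᵐ y ∂(hyperMeasure n c), Integrable fun t : ℝ => g (y + t • e) := by
  have := isLocallyFiniteMeasure_hyper hn c
  exact (integrable_hyper_prod hn he hg).prod_right_ae

/-- Almost every point of a hyperplane has a boundary value along the lines in a given transversal
direction. -/
theorem ae_exists_hasLineLimit {T : Set (Eucl d)} (hT : IsOpen T) {n e : Eucl d} {c : ℝ}
    (hn : ‖n‖ = 1) (he : inner ℝ n e ≠ 0) {v g : Eucl d → ℝ}
    (hv : Integrable v) (hvm : Measurable v) (hg : Integrable g) (hgm : Measurable g)
    (h : IsWeakDeriv T e v g) :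
    ∀ᵐ y ∂(hyperMeasure n c), ∀ δ > 0, (∀ s ∈ Ioo 0 δ, y + s • e ∈ T) →
      ∃ a, HasLineLimit v g e y δ a := by
  filter_upwards [ae_hyper_of_ae hn he (ae_ae_translate hT hv hvm hg hgm h),
    ae_integrable_line hn he hg] with y hy hint δ hδ hseg
  -- The boundary value is the almost everywhere constant value, on the line, of v minus the
  -- primitive of g.
  obtain ⟨a, ha⟩ := ae_const_of_ae_ae
    (u := fun s => v (y + s • e) - ∫ t in (0 : ℝ)..s, g (y + t • e)) hδ (by
    filter_upwards [hy] with s hs hsm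
    have hs2 : ∀ᵐ s' : ℝ, 0 ≤ s' - s → y + s • e ∈ segSet T e (s' - s) →
        v (y + s • e + (s' - s) • e) =
          v (y + s • e) + ∫ t in (0 : ℝ)..(s' - s), g (y + s • e + t • e) :=
      (measurePreserving_sub_right volume s).quasiMeasurePreserving.ae hs
    filter_upwards [hs2] with s' hs' hm
    have h1 : y + s • e ∈ segSet T e (s' - s) := by
      intro t ht
      rw [add_assoc, ← add_smul]
      exact hseg _ ⟨by linarith [ht.1, hsm.1], by linarith [ht.2, hm.2]⟩
    have h2 := hs' (by linarith [hm.1]) h1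
    simp only [add_assoc, ← add_smul, add_sub_cancel] at h2
    have h3 : ∫ t in (0 : ℝ)..(s' - s), g (y + (s + t) • e) = ∫ t in s..s', g (y + t • e) := by
      rw [intervalIntegral.integral_comp_add_left (fun t => g (y + t • e))]
      simp
    rw [h2, h3, ← intervalIntegral.integral_add_adjacent_intervals (a := 0) (b := s) (c := s')
      hint.intervalIntegrable hint.intervalIntegrable]
    ring)
  refine ⟨a, ?_⟩
  filter_upwards [ha] with s hs hm
  linarith [hs hm]

theorem abs_intervalIntegral_le {γ : ℝ → ℝ} (hγ : Integrable γ) (s : ℝ) :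
    |∫ t in (0 : ℝ)..s, γ t| ≤ ∫ t, |γ t| := by
  rw [← Real.norm_eq_abs]
  refine (intervalIntegral.norm_integral_le_integral_norm_uIoc).trans ?_
  exact setIntegral_le_integral hγ.norm (Eventually.of_forall fun t => norm_nonneg _)

theorem integrable_line_norm {n e : Eucl d} {c : ℝ} (hn : ‖n‖ = 1) (he : inner ℝ n e ≠ 0)
    {g : Eucl d → ℝ} (hg : Integrable g) :
    Integrable (fun y => ∫ t : ℝ, |g (y + t • e)|) (hyperMeasure n c) := by
  have := isLocallyFiniteMeasure_hyper hn c
  exact (integrable_hyper_prod hn he hg).norm.integral_prod_left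

/-- The boundary values along lines are integrable on the sets where these lines have a uniform
length inside `T`. -/
theorem exists_integrable_hasLineLimit {T : Set (Eucl d)} (hT : IsOpen T) {n e : Eucl d} {c : ℝ}
    (hn : ‖n‖ = 1) (he : inner ℝ n e ≠ 0) {v g : Eucl d → ℝ}
    (hv : Integrable v) (hvm : Measurable v) (hg : Integrable g) (hgm : Measurable g)
    (h : IsWeakDeriv T e v g) {S : Set (Eucl d)} (hS : MeasurableSet S) {δ : ℝ} (hδ : 0 < δ)
    (hseg : ∀ y ∈ S, ∀ s ∈ Ioo 0 δ, y + s • e ∈ T) :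
    ∃ b : Eucl d → ℝ, Integrable b (hyperMeasure n c) ∧
      ∀ᵐ y ∂(hyperMeasure n c), y ∈ S → HasLineLimit v g e y δ (b y) := by
  have hlf := isLocallyFiniteMeasure_hyper hn c
  let u : Eucl d × ℝ → ℝ := fun p => v (p.1 + p.2 • e) - ∫ t in (0 : ℝ)..p.2, g (p.1 + t • e)
  have hum : Measurable u :=
    (hvm.comp (by fun_prop)).sub (measurable_intervalIntegral_shift hgm e)
  -- On the good lines u(y, ·) is almost everywhere constant, so its mean over (0, δ) is the
  -- boundary value; the mean has the advantage of being measurable in y.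
  let b₀ : Eucl d → ℝ := fun y => δ⁻¹ * ∫ s in Ioo 0 δ, u (y, s)
  have hb₀ : Measurable b₀ :=
    (hum.stronglyMeasurable.integral_prod_right' (ν := volume.restrict (Ioo 0 δ))).measurable.const_mul _
  have hmain : ∀ᵐ y ∂(hyperMeasure n c), y ∈ S → HasLineLimit v g e y δ (b₀ y) := by
    filter_upwards [ae_exists_hasLineLimit hT hn he hv hvm hg hgm h] with y hy hyS
    obtain ⟨a, ha⟩ := hy δ hδ (hseg y hyS)
    have : ∫ s in Ioo 0 δ, u (y, s) = δ * a := by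
      rw [setIntegral_congr_ae (g := fun _ => a) measurableSet_Ioo]
      · simp [hδ.le]
      · filter_upwards [ha] with s hs hsm
        simp only [u]
        linarith [hs hsm]
    have h2 : b₀ y = a := by
      simp only [b₀]
      rw [this, inv_mul_cancel_left₀ hδ.ne']
    rwa [h2]
  refine ⟨S.indicator b₀, ?_, ?_⟩
  · refine Integrable.mono' (g := fun y => δ⁻¹ * (∫ s : ℝ, |v (y + s • e)|) +
      ∫ t : ℝ, |g (y + t • e)|) (((integrable_line_norm hn he hv).const_mul _).add
      (integrable_line_norm hn he hg)) (hb₀.indicator hS).aestronglyMeasurable ?_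
    filter_upwards [hmain, ae_integrable_line hn he hg, ae_integrable_line hn he hv]
      with y hy hig hiv
    have hnn : 0 ≤ δ⁻¹ * (∫ s : ℝ, |v (y + s • e)|) + ∫ t : ℝ, |g (y + t • e)| := by
      have h1 : 0 ≤ ∫ s : ℝ, |v (y + s • e)| := integral_nonneg fun _ => abs_nonneg _
      have h2 : 0 ≤ ∫ s : ℝ, |g (y + s • e)| := integral_nonneg fun _ => abs_nonneg _
      positivity
    by_cases hyS : y ∈ S
    swap
    · simpa [hyS] using hnn
    rw [indicator_of_mem hyS, Real.norm_eq_abs]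
    -- The bound |b₀ y| ≤ |v(y + se)| + ∫|g| is averaged over s. This is where a length δ uniform in
    -- y is needed.
    have h1 : ∫ s in Ioo 0 δ, (|b₀ y| - ∫ t : ℝ, |g (y + t • e)|) ≤
        ∫ s in Ioo 0 δ, |v (y + s • e)| := by
      refine setIntegral_mono_on_ae (integrableOn_const (by simp)) hiv.abs.integrableOn
        measurableSet_Ioo ?_
      filter_upwards [hy hyS] with s hs hsm
      have h3 := abs_intervalIntegral_le hig s
      have h4 : b₀ y = v (y + s • e) - ∫ t in (0 : ℝ)..s, g (y + t • e) := by linarith [hs hsm]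
      have h5 := abs_sub (v (y + s • e)) (∫ t in (0 : ℝ)..s, g (y + t • e))
      rw [← h4] at h5
      linarith
    have h2 : ∫ s in Ioo 0 δ, |v (y + s • e)| ≤ ∫ s : ℝ, |v (y + s • e)| :=
      setIntegral_le_integral hiv.abs (Eventually.of_forall fun _ => abs_nonneg _)
    have h3 := h1.trans h2
    simp only [integral_const, MeasurableSet.univ, measureReal_restrict_apply, univ_inter,
      Real.volume_real_Ioo, sub_zero, max_eq_left hδ.le, smul_eq_mul] at h3
    rw [← sub_le_iff_le_add, le_inv_mul_iff₀ hδ]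
    exact h3
  · filter_upwards [hmain] with y hy hyS
    rw [indicator_of_mem hyS]
    exact hy hyS

/-! ### The trace agrees with the boundary values along lines -/

/-- Near a flat boundary point, the mean oscillation on small balls is controlled by means on the
boundary hyperplane. -/
theorem exists_average_le_hyper {n e : Eucl d} (hn : ‖n‖ = 1) (he : inner ℝ n e < 0) (c : ℝ) :
    ∃ K C : ℝ, 0 ≤ K ∧ 0 < C ∧ ∀ (T : Set (Eucl d)) (v B : Eucl d → ℝ) (a ρ r : ℝ) (y : Eucl d),
      IsOpen T → Integrable v → LocallyIntegrable B (hyperMeasure n c) →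
      y ∈ hyperplane n c → 0 < r → r ≤ ρ →
      (∀ x ∈ Metric.ball y ρ, inner ℝ n x < c → x ∈ T) →
      (∀ x ∈ Metric.ball y ρ, c < inner ℝ n x → x ∉ T) →
      (∀ᵐ z ∂(hyperMeasure n c), z ∈ Metric.closedBall y (C * r) →
        ∀ᵐ s : ℝ, s ∈ Ioo 0 (C * r) → |v (z + s • e) - a| ≤ B z) →
      ⨍ x in T ∩ Metric.ball y r, |v x - a| ≤
        K * ⨍ z in Metric.closedBall y (C * r), B z ∂(hyperMeasure n c) := by
  have hlf := isLocallyFiniteMeasure_hyper hn c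
  set κ := inner ℝ n e with hκ
  have hκ0 : 0 < |κ| := abs_pos.2 he.ne
  have hd : d ≠ 0 := by
    rintro rfl
    rw [Subsingleton.elim n 0] at hn
    simp at hn
  -- If z lies on the hyperplane, s ≥ 0 and z + se is in the ball of radius r at y, then s|κ| < r
  -- and ‖z - y‖ ≤ r + s‖e‖. Hence C r bounds both s and ‖z - y‖.
  let C : ℝ := 1 + (1 + ‖e‖) / |κ|
  have hC : 0 < C := by positivity
  let β : ℝ := volume.real (Metric.ball (0 : Eucl d) 1)
  let β' : ℝ := volume.real (Metric.ball (0 : (ℝ ∙ n)ᗮ) 1)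
  have hβ : 0 < β :=
    ENNReal.toReal_pos (Metric.measure_ball_pos volume (0 : Eucl d) one_pos).ne'
      measure_ball_lt_top.ne
  have hβ' : 0 ≤ β' := measureReal_nonneg
  -- Upper bound: Jacobian |κ|, length C r, and a hyperplane ball of measure (C r)^(d-1) β'. Lower
  -- bound for the averaging volume: a ball of measure (r/2)^d β. Powers of r cancel in the
  -- quotient.
  refine ⟨|κ| * C ^ d * 2 ^ d * β' / β, C, by positivity, hC, ?_⟩
  intro T v B a ρ r y hT hv hB hy hr hrρ hlow hup hbound
  have hfinV : volume (T ∩ Metric.ball y r) < ⊤ :=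
    (measure_mono inter_subset_right).trans_lt measure_ball_lt_top
  have hTm : MeasurableSet (T ∩ Metric.ball y r) := hT.measurableSet.inter measurableSet_ball
  have hvol : (r / 2) ^ d * β ≤ volume.real (T ∩ Metric.ball y r) := by
    -- This ball is tangent to the hyperplane from below and contained in `T ∩ ball y r`.
    have h1 : volume.real (Metric.ball (y - (r / 2) • n) (r / 2)) = (r / 2) ^ d * β := by
      rw [measureReal_def, Measure.addHaar_ball_of_pos _ _ (half_pos hr), ENNReal.toReal_mul,
        ENNReal.toReal_ofReal (by positivity), finrank_euclideanSpace_fin]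
      rfl
    rw [← h1]
    refine measureReal_mono (fun x hx => ?_) hfinV.ne
    rw [Metric.mem_ball, dist_eq_norm] at hx
    have hxy : ‖x - y‖ < r := by
      have : x - y = (x - (y - (r / 2) • n)) - (r / 2) • n := by abel
      rw [this]
      refine (norm_sub_le _ _).trans_lt ?_
      rw [norm_smul, hn, Real.norm_of_nonneg (half_pos hr).le]
      linarith
    refine ⟨hlow x (by rw [Metric.mem_ball, dist_eq_norm]; exact hxy.trans_le hrρ) ?_, by
      rwa [Metric.mem_ball, dist_eq_norm]⟩
    have h2 := real_inner_le_norm n (x - (y - (r / 2) • n))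
    rw [hn, one_mul, inner_sub_right, inner_sub_right, inner_smul_right,
      real_inner_self_eq_norm_sq, hn] at h2
    have hy' : inner ℝ n y = c := hy
    rw [hy'] at h2
    linarith
  have hvol0 : 0 < (r / 2) ^ d * β := by positivity
  have hσ : (hyperMeasure n c).real (Metric.closedBall y (C * r)) = (C * r) ^ (d - 1) * β' := by
    rw [measureReal_def, hyperMeasure_closedBall hn hy (by positivity), ENNReal.toReal_mul,
      ENNReal.toReal_ofReal (by positivity)]
    rfl
  let f : Eucl d → ℝ := (T ∩ Metric.ball y r).indicator fun x => |v x - a|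
  have hf : Integrable f := by
    refine IntegrableOn.integrable_indicator ?_ hTm
    exact (hv.integrableOn.sub (integrableOn_const hfinV.ne)).abs
  have hI : ∫ x in T ∩ Metric.ball y r, |v x - a| ≤
      |κ| * (C * r * ∫ z in Metric.closedBall y (C * r), B z ∂(hyperMeasure n c)) := by
    rw [← integral_indicator hTm, integral_eq_hyper hn he.ne hf]
    refine mul_le_mul_of_nonneg_left ?_ (abs_nonneg _)
    rw [← integral_const_mul, ← integral_indicator measurableSet_closedBall]
    refine integral_mono_ae (integrable_hyper_prod hn he.ne hf).integral_prod_left ?_ ?_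
    · exact IntegrableOn.integrable_indicator
        ((hB.integrableOn_isCompact (isCompact_closedBall _ _)).const_mul _) measurableSet_closedBall
    filter_upwards [hbound, ae_mem_hyperplane n c, ae_integrable_line hn he.ne hf]
      with z hz hzH hfz
    have hsupp : ∀ s : ℝ, z + s • e ∈ T ∩ Metric.ball y r →
        0 ≤ s ∧ s < C * r ∧ z ∈ Metric.closedBall y (C * r) := by
      rintro s ⟨hsT, hsb⟩
      have hzs : inner ℝ n (z + s • e) = c + s * κ := by
        rw [inner_add_right, inner_smul_right, show inner ℝ n z = c from hzH]
      have h1 : ¬ c < inner ℝ n (z + s • e) := fun H =>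
        hup _ (Metric.ball_subset_ball hrρ hsb) H hsT
      rw [hzs] at h1
      have hs0 : 0 ≤ s := by
        by_contra! hneg
        exact h1 (by linarith [mul_pos_of_neg_of_neg hneg he])
      rw [Metric.mem_ball, dist_eq_norm] at hsb
      have h2 := (abs_real_inner_le_norm n (z + s • e - y)).trans_eq (by rw [hn, one_mul])
      rw [inner_sub_right, hzs, show inner ℝ n y = c from hy, add_sub_cancel_left, abs_mul,
        abs_of_nonneg hs0] at h2
      have hsr : s < r / |κ| := by
        rw [lt_div_iff₀ hκ0]
        linarith
      have hCr : C * r = r + r / |κ| + ‖e‖ * (r / |κ|) := by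
        simp only [C]
        field_simp
        ring
      have hp : 0 ≤ ‖e‖ * (r / |κ|) := by positivity
      refine ⟨hs0, by linarith, ?_⟩
      rw [Metric.mem_closedBall, dist_eq_norm]
      have h3 : z - y = (z + s • e - y) - s • e := by abel
      rw [h3]
      refine (norm_sub_le _ _).trans ?_
      rw [norm_smul, Real.norm_of_nonneg hs0]
      have h4 : s * ‖e‖ ≤ ‖e‖ * (r / |κ|) := by
        rw [mul_comm]
        exact mul_le_mul_of_nonneg_left hsr.le (norm_nonneg _)
      have h5 : 0 < r / |κ| := by positivity
      linarith
    by_cases hzB : z ∈ Metric.closedBall y (C * r)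
    swap
    · rw [indicator_of_notMem hzB]
      refine (integral_eq_zero_of_ae (Eventually.of_forall fun s => ?_)).le
      exact indicator_of_notMem (fun H => hzB (hsupp s H).2.2) _
    rw [indicator_of_mem hzB]
    have hle : ∫ s : ℝ, f (z + s • e) ≤ ∫ s : ℝ, (Ioo 0 (C * r)).indicator (fun _ => B z) s := by
      refine integral_mono_ae hfz ((integrable_indicator_iff measurableSet_Ioo).2
        (integrableOn_const (by simp))) ?_
      have h0 : ∀ᵐ s : ℝ, s ≠ 0 := by simp [ae_iff]
      filter_upwards [hz hzB, h0] with s hs hs0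
      by_cases hmem : s ∈ Ioo 0 (C * r)
      · rw [indicator_of_mem hmem]
        refine le_trans ?_ (hs hmem)
        exact indicator_le_self' (fun _ _ => abs_nonneg _) _
      · rw [indicator_of_notMem hmem]
        refine (indicator_of_notMem (fun H => hmem ?_) _).le
        exact ⟨lt_of_le_of_ne (hsupp s H).1 hs0.symm, (hsupp s H).2.1⟩
    refine hle.trans_eq ?_
    rw [integral_indicator measurableSet_Ioo]
    simp [(mul_pos hC hr).le]
  have hJ : ∫ z in Metric.closedBall y (C * r), B z ∂(hyperMeasure n c) =
      (C * r) ^ (d - 1) * β' * ⨍ z in Metric.closedBall y (C * r), B z ∂(hyperMeasure n c) := by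
    rw [← hσ]
    exact (measure_smul_setAverage B measure_closedBall_lt_top.ne).symm
  rw [setAverage_eq, smul_eq_mul, inv_mul_le_iff₀ (hvol0.trans_le hvol)]
  have hInn : 0 ≤ ∫ x in T ∩ Metric.ball y r, |v x - a| := integral_nonneg fun _ => abs_nonneg _
  set A := ⨍ z in Metric.closedBall y (C * r), B z ∂(hyperMeasure n c)
  have hpow : C * r * ((C * r) ^ (d - 1)) = C ^ d * r ^ d := by
    rw [← pow_succ', Nat.sub_add_cancel (Nat.one_le_iff_ne_zero.2 hd), mul_pow]
  have hfinal : |κ| * (C * r * ((C * r) ^ (d - 1) * β' * A)) =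
      (r / 2) ^ d * β * (|κ| * C ^ d * 2 ^ d * β' / β * A) := by
    have : |κ| * (C * r * ((C * r) ^ (d - 1) * β' * A)) =
      |κ| * (C * r * ((C * r) ^ (d - 1))) * β' * A := by ring
    rw [this, hpow, div_pow]
    field_simp
  rw [hJ, hfinal] at hI
  refine hI.trans ?_
  -- `B` is not assumed nonnegative; the sign is read off from the integral already bounded above.
  have hKA : 0 ≤ |κ| * C ^ d * 2 ^ d * β' / β * A := by
    have := hInn.trans hI
    exact nonneg_of_mul_nonneg_right this hvol0
  exact mul_le_mul_of_nonneg_right hvol hKA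

/-- Triangle inequality under the average. Membership in the closure keeps `T ∩ ball x r` of
positive measure; otherwise the averages would be 0 by convention. -/
theorem IsTraceAt.unique {T : Set (Eucl d)} (hT : IsOpen T) {v : Eucl d → ℝ} (hv : Integrable v)
    {x : Eucl d} (hx : x ∈ closure T) {a b : ℝ} (ha : IsTraceAt T v x a)
    (hb : IsTraceAt T v x b) : a = b := by
  have hle : ∀ᶠ r in 𝓝[>] (0 : ℝ), |a - b| ≤
      (⨍ y in T ∩ Metric.ball x r, |v y - a|) + ⨍ y in T ∩ Metric.ball x r, |v y - b| := by
    filter_upwards [self_mem_nhdsWithin] with r hr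
    have hfinV : volume (T ∩ Metric.ball x r) < ⊤ :=
      (measure_mono inter_subset_right).trans_lt measure_ball_lt_top
    have hne : (T ∩ Metric.ball x r).Nonempty := by
      obtain ⟨z, hz, hzT⟩ := mem_closure_iff.1 hx _ Metric.isOpen_ball (Metric.mem_ball_self hr)
      exact ⟨z, hzT, hz⟩
    have hpos : volume (T ∩ Metric.ball x r) ≠ 0 :=
      ((hT.inter Metric.isOpen_ball).measure_pos volume hne).ne'
    have hint : ∀ a : ℝ, IntegrableOn (fun y => |v y - a|) (T ∩ Metric.ball x r) := fun a =>
      (hv.integrableOn.sub (integrableOn_const hfinV.ne)).abs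
    have hc := setAverage_const hpos hfinV.ne |a - b|
    rw [← hc]
    simp only [setAverage_eq]
    rw [← smul_add, ← integral_add (hint a) (hint b)]
    refine smul_le_smul_of_nonneg_left ?_ (by positivity)
    refine integral_mono (f := fun _ => |a - b|) (integrableOn_const hfinV.ne)
      ((hint a).add (hint b)) fun y => ?_
    have := abs_sub_le a (v y) b
    rwa [abs_sub_comm a (v y)] at this
  have hlim := ge_of_tendsto (ha.add hb) hle
  have h0 : |a - b| = 0 := le_antisymm (by simpa using hlim) (abs_nonneg _)
  exact sub_eq_zero.1 (abs_eq_zero.1 h0)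

theorem IsTraceAt.trace_eq {T : Set (Eucl d)} (hT : IsOpen T) {v : Eucl d → ℝ} (hv : Integrable v)
    {x : Eucl d} (hx : x ∈ closure T) {a : ℝ} (ha : IsTraceAt T v x a) : trace T v x = a := by
  have hex : ∃ a, IsTraceAt T v x a := ⟨a, ha⟩
  rw [trace, dif_pos hex]
  exact IsTraceAt.unique hT hv hx hex.choose_spec ha

/-- `y` is a boundary point near which `T` is the half space below the hyperplane. -/
def IsFlatPoint (T : Set (Eucl d)) (n : Eucl d) (c : ℝ) (y : Eucl d) : Prop :=
  inner ℝ n y = c ∧ ∃ ρ > 0, (∀ x ∈ Metric.ball y ρ, inner ℝ n x < c → x ∈ T) ∧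
    (∀ x ∈ Metric.ball y ρ, c < inner ℝ n x → x ∉ T)

theorem IsFlatPoint.exists_add_smul_mem {T : Set (Eucl d)} {n y e : Eucl d} {c : ℝ}
    (hy : IsFlatPoint T n c y) (he : inner ℝ n e < 0) :
    ∃ δ > (0 : ℝ), ∀ s ∈ Ioo 0 δ, y + s • e ∈ T := by
  obtain ⟨hyc, ρ, hρ, hlow, -⟩ := hy
  refine ⟨ρ / (‖e‖ + 1), by positivity, fun s hs => hlow _ ?_ ?_⟩
  · rw [Metric.mem_ball, dist_eq_norm, add_sub_cancel_left, norm_smul, Real.norm_of_nonneg hs.1.le]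
    have h1 := hs.2
    rw [lt_div_iff₀ (by positivity)] at h1
    nlinarith [hs.1]
  · rw [inner_add_right, hyc, inner_smul_right]
    nlinarith [hs.1]

/-- Near a flat boundary point, the trace is the boundary value along the lines in any transversal
direction. -/
theorem ae_ball_hasLineLimit_trace {T : Set (Eucl d)} (hT : IsOpen T) {n e : Eucl d} {c : ℝ}
    (hn : ‖n‖ = 1) (he : inner ℝ n e < 0) {v g : Eucl d → ℝ}
    (hv : Integrable v) (hvm : Measurable v) (hg : Integrable g) (hgm : Measurable g)
    (h : IsWeakDeriv T e v g) {y₀ : Eucl d} {ρ : ℝ} (hρ : 0 < ρ)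
    (hlow : ∀ x ∈ Metric.ball y₀ ρ, inner ℝ n x < c → x ∈ T)
    (hup : ∀ x ∈ Metric.ball y₀ ρ, c < inner ℝ n x → x ∉ T) :
    ∀ᵐ y ∂(hyperMeasure n c), y ∈ Metric.ball y₀ (ρ / 2) →
      ∃ δ > 0, HasLineLimit v g e y δ (trace T v y) := by
  have hlf := isLocallyFiniteMeasure_hyper hn c
  let S : Set (Eucl d) := Metric.ball y₀ (ρ / 2) ∩ hyperplane n c
  have hS : MeasurableSet S := measurableSet_ball.inter (measurableSet_hyperplane n c)
  let δ : ℝ := ρ / 2 / (‖e‖ + 1)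
  have hδ : 0 < δ := by positivity
  have hseg : ∀ y ∈ S, ∀ s ∈ Ioo 0 δ, y + s • e ∈ T := by
    rintro y ⟨hyb, hyH⟩ s hs
    have h1 := hs.2
    rw [lt_div_iff₀ (by positivity)] at h1
    refine hlow _ ?_ ?_
    · rw [Metric.mem_ball, dist_eq_norm] at hyb ⊢
      have : y + s • e - y₀ = (y - y₀) + s • e := by abel
      rw [this]
      refine (norm_add_le _ _).trans_lt ?_
      rw [norm_smul, Real.norm_of_nonneg hs.1.le]
      nlinarith [hs.1]
    · rw [inner_add_right, show inner ℝ n y = c from hyH, inner_smul_right]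
      nlinarith [hs.1]
  obtain ⟨b, hb, hbl⟩ := exists_integrable_hasLineLimit hT hn he.ne hv hvm hg hgm h hS hδ hseg
  obtain ⟨K, C, hK, hC, hav⟩ := exists_average_le_hyper hn he c
  -- `G k` dominates the primitive of g for lengths below 1/(k+1), and tends to 0 pointwise where g
  -- is integrable on the line.
  let G : ℕ → Eucl d → ℝ := fun k y => ∫ t in Ioo (0 : ℝ) (1 / (k + 1)), |g (y + t • e)|
  have hG : ∀ k, Integrable (G k) (hyperMeasure n c) := by
    intro k
    have h1 := (integrable_hyper_prod (c := c) hn he.ne hg).norm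
    have h2 : Integrable (fun p : Eucl d × ℝ => ‖g (p.1 + p.2 • e)‖)
        ((hyperMeasure n c).prod (volume.restrict (Ioo (0 : ℝ) (1 / (k + 1))))) := by
      refine h1.mono_measure ?_
      exact Measure.prod_mono le_rfl Measure.restrict_le_self
    exact h2.integral_prod_left
  -- The good points are the Lebesgue points of `b` at which the averages of every `G k` also
  -- converge; countability of k keeps the exceptional set null.
  have hLb := (Besicovitch.vitaliFamily (hyperMeasure n c)).ae_tendsto_average_norm_sub
    hb.locallyIntegrable
  have hLG : ∀ᵐ y ∂(hyperMeasure n c), ∀ k, Tendsto (fun A => ⨍ z in A, G k z ∂(hyperMeasure n c))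
      ((Besicovitch.vitaliFamily (hyperMeasure n c)).filterAt y) (𝓝 (G k y)) :=
    ae_all_iff.2 fun k =>
      (Besicovitch.vitaliFamily (hyperMeasure n c)).ae_tendsto_average (hG k).locallyIntegrable
  filter_upwards [hbl, hLb, hLG, ae_mem_hyperplane n c, ae_integrable_line hn he.ne hg]
    with y hyl hyb hyG hyH hyg hyball
  have hyS : y ∈ S := ⟨hyball, hyH⟩
  refine ⟨δ, hδ, ?_⟩
  have hcl : y ∈ closure T := by
    refine mem_closure_iff_frequently.2 ?_
    have hcont : ContinuousWithinAt (fun s : ℝ => y + s • e) (Ioi 0) 0 := by fun_prop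
    have ht : Tendsto (fun s : ℝ => y + s • e) (𝓝[>] 0) (𝓝 y) := by
      have := hcont.tendsto
      simpa using this
    refine ht.frequently (Eventually.frequently ?_)
    filter_upwards [Ioo_mem_nhdsGT hδ] with s hs using hseg y hyS s hs
  suffices htr : IsTraceAt T v y (b y) by
    rw [IsTraceAt.trace_eq hT hv hcl htr]
    exact hyl hyS
  have hGlim : Tendsto (fun k => G k y) atTop (𝓝 0) := by
    have hempty : ⋂ k : ℕ, Ioo (0 : ℝ) (1 / (k + 1)) = ∅ := by
      ext t
      simp only [mem_iInter, mem_empty_iff_false, iff_false, not_forall]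
      by_cases ht : 0 < t
      · obtain ⟨k, hk⟩ := exists_nat_one_div_lt ht
        exact ⟨k, fun H => lt_asymm hk H.2⟩
      · exact ⟨0, fun H => ht H.1⟩
    have hanti : Antitone fun k : ℕ => Ioo (0 : ℝ) (1 / ((k : ℝ) + 1)) := fun k l hkl =>
      Ioo_subset_Ioo_right (one_div_le_one_div_of_le (by positivity) (by gcongr))
    have := tendsto_setIntegral_of_antitone (μ := volume) (f := fun t : ℝ => |g (y + t • e)|)
      (fun k => measurableSet_Ioo) hanti ⟨0, hyg.abs.integrableOn⟩
    rw [hempty, setIntegral_empty] at this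
    exact this
  have hCr : Tendsto (fun r : ℝ => C * r) (𝓝[>] 0) (𝓝[>] 0) := by
    refine tendsto_nhdsWithin_iff.2 ⟨?_, ?_⟩
    · have : ContinuousWithinAt (fun r : ℝ => C * r) (Ioi 0) 0 := by fun_prop
      simpa using this.tendsto
    · filter_upwards [self_mem_nhdsWithin] with r hr using mul_pos hC hr
  have hball := (Besicovitch.tendsto_filterAt (hyperMeasure n c) y).comp hCr
  have h1 := hyb.comp hball
  have h2 := fun k => (hyG k).comp hball
  have hkey : ∀ k : ℕ, ∀ᶠ r in 𝓝[>] (0 : ℝ), ⨍ x in T ∩ Metric.ball y r, |v x - b y| ≤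
      K * ((⨍ z in Metric.closedBall y (C * r), ‖b z - b y‖ ∂(hyperMeasure n c)) +
        ⨍ z in Metric.closedBall y (C * r), G k z ∂(hyperMeasure n c)) := by
    intro k
    have hk : (0 : ℝ) < 1 / (k + 1) := by positivity
    have hgap : 0 < ρ / 2 - dist y y₀ := by linarith [Metric.mem_ball.1 hyball]
    have hCr' := tendsto_nhds_of_tendsto_nhdsWithin hCr
    filter_upwards [self_mem_nhdsWithin, Ioo_mem_nhdsGT (half_pos hρ),
      hCr'.eventually_lt_const hδ, hCr'.eventually_lt_const hk, hCr'.eventually_lt_const hgap]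
      with r hr0 hrρ hrδ hrk hrg
    have hsub : Metric.ball y (ρ / 2) ⊆ Metric.ball y₀ ρ := by
      refine Metric.ball_subset_ball' ?_
      linarith [Metric.mem_ball.1 hyball]
    have hloc : LocallyIntegrable (fun z => ‖b z - b y‖) (hyperMeasure n c) :=
      fun z => IntegrableAtFilter.norm
        ((hb.locallyIntegrable.sub (locallyIntegrable_const (b y))) z)
    have hmain := hav T v (fun z => ‖b z - b y‖ + G k z) (b y) (ρ / 2) r y hT hv
      (hloc.add (hG k).locallyIntegrable) hyH hr0 hrρ.2.le
      (fun x hx => hlow x (hsub hx)) (fun x hx => hup x (hsub hx)) (by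
        filter_upwards [hbl, ae_mem_hyperplane n c, ae_integrable_line hn he.ne hg]
          with z hz hzH hzg hzb
        have hzS : z ∈ S := by
          refine ⟨?_, hzH⟩
          rw [Metric.mem_ball]
          have := dist_triangle z y y₀
          linarith [Metric.mem_closedBall.1 hzb]
        filter_upwards [hz hzS] with s hs hsm
        rw [hs ⟨hsm.1, hsm.2.trans hrδ⟩]
        have h3 : |∫ t in (0 : ℝ)..s, g (z + t • e)| ≤ G k z := by
          rw [intervalIntegral.integral_of_le hsm.1.le, ← Real.norm_eq_abs]
          refine (norm_integral_le_integral_norm _).trans ?_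
          refine setIntegral_mono_set hzg.norm.integrableOn
            (Eventually.of_forall fun t => norm_nonneg _) (Eventually.of_forall fun t ht => ?_)
          exact ⟨ht.1, ht.2.trans_lt (hsm.2.trans hrk)⟩
        have h4 : b z + (∫ t in (0 : ℝ)..s, g (z + t • e)) - b y =
            (b z - b y) + ∫ t in (0 : ℝ)..s, g (z + t • e) := by ring
        rw [h4]
        exact (abs_add_le _ _).trans (add_le_add le_rfl h3))
    refine hmain.trans_eq ?_
    simp only [setAverage_eq]
    rw [integral_add (hloc.integrableOn_isCompact (isCompact_closedBall _ _)) (hG k).integrableOn,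
      smul_add]
  rw [IsTraceAt, Metric.tendsto_nhds]
  intro ε hε
  -- For fixed k the upper bound tends to K · G k y as r → 0; k is chosen beforehand to make this
  -- smaller than ε.
  have hKG : Tendsto (fun k => K * (0 + G k y)) atTop (𝓝 0) := by
    simpa using (hGlim.const_add 0).const_mul K
  obtain ⟨k, hk⟩ := (hKG.eventually_lt_const hε).exists
  filter_upwards [hkey k, ((h1.add (h2 k)).const_mul K).eventually_lt_const hk] with r hr1 hr2
  rw [Real.dist_eq, sub_zero, abs_of_nonneg]
  · exact hr1.trans_lt hr2
  · rw [setAverage_eq, smul_eq_mul]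
    exact mul_nonneg (by positivity) (integral_nonneg fun _ => abs_nonneg _)

/-- At almost every flat boundary point, the trace is the boundary value along the lines in a given
transversal direction. -/
theorem ae_hasLineLimit_trace {T : Set (Eucl d)} (hT : IsOpen T) {n e : Eucl d} {c : ℝ}
    (hn : ‖n‖ = 1) (he : inner ℝ n e < 0) {v g : Eucl d → ℝ}
    (hv : Integrable v) (hvm : Measurable v) (hg : Integrable g) (hgm : Measurable g)
    (h : IsWeakDeriv T e v g) :
    ∀ᵐ y ∂(hyperMeasure n c), IsFlatPoint T n c y → ∀ δ > 0, (∀ s ∈ Ioo 0 δ, y + s • e ∈ T) →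
      HasLineLimit v g e y δ (trace T v y) := by
  have hloc : ∀ᵐ y ∂(hyperMeasure n c), IsFlatPoint T n c y →
      ∃ δ > 0, HasLineLimit v g e y δ (trace T v y) := by
    rw [ae_iff]
    -- Only flat points matter, and each has a ball on which the local statement applies.
    refine measure_null_of_locally_null _ fun y₀ hy₀ => ?_
    simp only [mem_ofPred_eq, Classical.not_imp] at hy₀
    obtain ⟨⟨hyc, ρ, hρ, hlow, hup⟩, -⟩ := hy₀
    refine ⟨Metric.ball y₀ (ρ / 2) ∩ {y | ¬(IsFlatPoint T n c y →
      ∃ δ > 0, HasLineLimit v g e y δ (trace T v y))}, ?_, ?_⟩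
    · exact inter_mem (mem_nhdsWithin_of_mem_nhds (Metric.ball_mem_nhds _ (half_pos hρ)))
        self_mem_nhdsWithin
    · refine measure_mono_null (fun y hy => ?_)
        (ae_ball_hasLineLimit_trace hT hn he hv hvm hg hgm h hρ hlow hup)
      exact fun H => hy.2 fun _ => H hy.1
  filter_upwards [hloc, ae_exists_hasLineLimit hT hn he.ne hv hvm hg hgm h] with y hy hex hflat δ hδ hs
  -- The length from the local statement is replaced by an arbitrary admissible one: both boundary
  -- values agree on the shorter interval.
  obtain ⟨δ', hδ', hl⟩ := hy hflat
  obtain ⟨a, ha⟩ := hex δ hδ hs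
  rwa [HasLineLimit.unique hδ' hδ hl ha]

/-! ### Local geometry of the boundary: almost every face point is flat -/

namespace PolyhedralElement

theorem exists_offset (T : PolyhedralElement d) : ∃ c : Set (Eucl d) → ℝ, ∀ F ∈ T.faces,
    ∃ U : Set (Eucl d), IsOpen U ∧ F = U ∩ hyperplane (T.normal F) (c F) := by
  have : ∀ F : Set (Eucl d), ∃ c : ℝ, F ∈ T.faces →
      ∃ U : Set (Eucl d), IsOpen U ∧ F = U ∩ hyperplane (T.normal F) c := by
    intro F
    by_cases hF : F ∈ T.faces
    · obtain ⟨U, c, hU, h⟩ := T.face_planar F hF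
      exact ⟨c, fun _ => ⟨U, hU, h⟩⟩
    · exact ⟨0, fun h => absurd h hF⟩
  choose c hc using this
  exact ⟨c, hc⟩

/-- The offset of the hyperplane of a face. -/
def offset (T : PolyhedralElement d) : Set (Eucl d) → ℝ := T.exists_offset.choose

/-- The hyperplane of a face. -/
def plane (T : PolyhedralElement d) (F : Set (Eucl d)) : Set (Eucl d) :=
  hyperplane (T.normal F) (T.offset F)

/-- The surface measure on the hyperplane of a face. -/
def planeMeasure (T : PolyhedralElement d) (F : Set (Eucl d)) : Measure (Eucl d) :=
  hyperMeasure (T.normal F) (T.offset F)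

theorem face_eq (T : PolyhedralElement d) {F : Set (Eucl d)} (hF : F ∈ T.faces) :
    ∃ U : Set (Eucl d), IsOpen U ∧ F = U ∩ T.plane F := T.exists_offset.choose_spec F hF

theorem isClosed_plane (T : PolyhedralElement d) (F : Set (Eucl d)) : IsClosed (T.plane F) :=
  isClosed_hyperplane _ _

theorem face_subset_plane (T : PolyhedralElement d) {F : Set (Eucl d)} (hF : F ∈ T.faces) :
    F ⊆ T.plane F := by
  obtain ⟨U, -, h⟩ := T.face_eq hF
  rw [h]
  exact fun x hx => by rw [← h]; exact hx.2

theorem closure_face_subset_plane (T : PolyhedralElement d) {F : Set (Eucl d)} (hF : F ∈ T.faces) :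
    closure F ⊆ T.plane F :=
  closure_minimal (T.face_subset_plane hF) (T.isClosed_plane F)

theorem measurableSet_face (T : PolyhedralElement d) {F : Set (Eucl d)} (hF : F ∈ T.faces) :
    MeasurableSet F := by
  obtain ⟨U, hU, h⟩ := T.face_eq hF
  rw [h]
  exact hU.measurableSet.inter (measurableSet_hyperplane _ _)

theorem closure_face_subset_frontier (T : PolyhedralElement d) {F : Set (Eucl d)}
    (hF : F ∈ T.faces) : closure F ⊆ frontier T.carrier := by
  rw [T.frontier_eq]
  exact subset_biUnion_of_mem (u := fun F => closure F) hF

theorem frontier_subset (T : PolyhedralElement d) :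
    frontier T.carrier ⊆ ⋃ F ∈ T.faces, T.plane F := by
  rw [T.frontier_eq]
  exact iUnion₂_mono fun F hF => T.closure_face_subset_plane hF

theorem isCompact_closure_face (T : PolyhedralElement d) {F : Set (Eucl d)} (hF : F ∈ T.faces) :
    IsCompact (closure F) := by
  refine Metric.isCompact_of_isClosed_isBounded isClosed_closure ?_
  exact T.isBounded_carrier.closure.subset
    ((T.closure_face_subset_frontier hF).trans frontier_subset_closure)

theorem surf_restrict_face (T : PolyhedralElement d) {F : Set (Eucl d)} (hF : F ∈ T.faces) :
    (surf d).restrict F = (T.planeMeasure F).restrict F := by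
  rw [planeMeasure, hyperMeasure, Measure.restrict_restrict (T.measurableSet_face hF)]
  congr 1
  exact (inter_eq_left.2 (T.face_subset_plane hF)).symm

theorem isLocallyFinite_planeMeasure (T : PolyhedralElement d) {F : Set (Eucl d)}
    (hF : F ∈ T.faces) : IsLocallyFiniteMeasure (T.planeMeasure F) :=
  isLocallyFiniteMeasure_hyper (T.norm_normal F hF) _

theorem surf_face_lt_top (T : PolyhedralElement d) {F : Set (Eucl d)} (hF : F ∈ T.faces) :
    surf d F < ⊤ := by
  have := T.isLocallyFinite_planeMeasure hF
  rw [← Measure.restrict_apply_self, T.surf_restrict_face hF, Measure.restrict_apply_self]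
  exact (measure_mono subset_closure).trans_lt (T.isCompact_closure_face hF).measure_lt_top

/-- A face does not meet the closure of another one, up to a null set. -/
theorem ae_notMem_closure_face (T : PolyhedralElement d) {F G : Set (Eucl d)} (hF : F ∈ T.faces)
    (hG : G ∈ T.faces) (hne : G ≠ F) :
    ∀ᵐ y ∂(T.planeMeasure F), y ∈ F → y ∉ closure G := by
  -- Either the two planes meet in a null set, or they coincide near the point; then relative
  -- openness of `F` together with disjointness of the faces excludes it.
  by_cases hsub : T.plane F ⊆ T.plane G
  swap
  · obtain ⟨z, hz, hzG⟩ := not_subset.1 hsub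
    have h0 := hyperMeasure_hyperplane (T.norm_normal F hF) hz hzG
    filter_upwards [measure_eq_zero_iff_ae_notMem.1 h0] with y hy _ hyG
    exact hy (T.closure_face_subset_plane hG hyG)
  · refine Eventually.of_forall fun y hyF hyG => ?_
    obtain ⟨U, hU, hFU⟩ := T.face_eq hF
    have hyU : y ∈ U := (hFU ▸ hyF : y ∈ U ∩ T.plane F).1
    obtain ⟨z, hzU, hzG⟩ := mem_closure_iff.1 hyG U hU hyU
    have hyp : inner ℝ (T.normal F) y = T.offset F := T.face_subset_plane hF hyF
    have hyq : inner ℝ (T.normal G) y = T.offset G := T.closure_face_subset_plane hG hyG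
    have hzq : inner ℝ (T.normal G) z = T.offset G := T.face_subset_plane hG hzG
    set n := T.normal F
    set m := T.normal G
    have hn : inner ℝ n n = 1 := by
      rw [real_inner_self_eq_norm_sq, T.norm_normal F hF, one_pow]
    have hm : inner ℝ m m = 1 := by
      rw [real_inner_self_eq_norm_sq, T.norm_normal G hG, one_pow]
    -- The component of `m` orthogonal to `n`. Translation by w preserves the plane of `F`,
    -- contained in that of `G`, so w is orthogonal to `m` as well; hence w = 0 and the normals are
    -- parallel.
    set w := m - (inner ℝ n m) • n with hw
    have hnw : inner ℝ n w = 0 := by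
      rw [hw, inner_sub_right, inner_smul_right, hn, mul_one, sub_self]
    have hmw : inner ℝ m w = 0 := by
      have h1 : y + w ∈ T.plane F := by
        change inner ℝ n (y + w) = _
        rw [inner_add_right, hnw, add_zero, hyp]
      have h2 : inner ℝ m (y + w) = T.offset G := hsub h1
      rw [inner_add_right, hyq] at h2
      linarith
    have hw0 : w = 0 := by
      rw [← inner_self_eq_zero (𝕜 := ℝ)]
      nth_rw 1 [hw]
      rw [inner_sub_left, inner_smul_left, hnw, hmw]
      simp
    have hmn : m = (inner ℝ n m) • n := sub_eq_zero.1 hw0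
    have hzp : inner ℝ n z = T.offset F := by
      have h1 : inner ℝ m (z - y) = 0 := by rw [inner_sub_right, hzq, hyq, sub_self]
      have h2 : inner ℝ n m ≠ 0 := by
        intro h
        rw [h, zero_smul] at hmn
        rw [hmn] at hm
        simp at hm
      rw [hmn, inner_smul_left, inner_sub_right, hyp] at h1
      rcases mul_eq_zero.1 h1 with h3 | h3
      · exact absurd h3 h2
      · linarith
    have hzF : z ∈ F := by
      rw [hFU]
      exact ⟨hzU, hzp⟩
    exact (T.face_disjoint G hG F hF hne).ne_of_mem hzG hzF rfl

/-- Off the frontier, the space is the disjoint union of two open sets, `T` and the complement of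
its closure. -/
theorem subset_of_isPreconnected (T : PolyhedralElement d) {A : Set (Eucl d)}
    (hA : IsPreconnected A) (hfr : Disjoint A (frontier T.carrier))
    (hne : (A ∩ T.carrier).Nonempty) : A ⊆ T.carrier := by
  refine hA.subset_left_of_subset_union T.isOpen_carrier isClosed_closure.isOpen_compl
    (disjoint_compl_right.mono_left subset_closure) (fun x hx => ?_) hne
  by_cases hxT : x ∈ T.carrier
  · exact Or.inl hxT
  · refine Or.inr fun hxc => hfr.ne_of_mem hx ?_ rfl
    rw [frontier, T.isOpen_carrier.interior_eq]
    exact ⟨hxc, hxT⟩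

/-- Almost every point of a closed face belongs to the face and is a flat boundary point. -/
theorem ae_isFlatPoint (T : PolyhedralElement d) {F : Set (Eucl d)} (hF : F ∈ T.faces) :
    ∀ᵐ y ∂(T.planeMeasure F), y ∈ closure F →
      y ∈ F ∧ IsFlatPoint T.carrier (T.normal F) (T.offset F) y := by
  have h1 : ∀ᵐ y ∂(T.planeMeasure F), y ∉ closure F \ F := by
    rw [← measure_eq_zero_iff_ae_notMem]
    exact le_antisymm ((Measure.restrict_apply_le _ _).trans_eq (T.face_boundary_null F hF))
      (zero_le)
  have h2 : ∀ᵐ y ∂(T.planeMeasure F), y ∈ F → ∃ ε > 0, ∀ t ∈ Ioo (0 : ℝ) ε,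
        y - t • T.normal F ∈ T.carrier ∧ y + t • T.normal F ∉ T.carrier := by
    rw [← ae_restrict_iff' (T.measurableSet_face hF), ← T.surf_restrict_face hF]
    exact T.normal_outward F hF
  have h3 : ∀ᵐ y ∂(T.planeMeasure F), ∀ G ∈ T.faces, G ≠ F → y ∈ F → y ∉ closure G := by
    refine (ae_ball_iff T.faces.countable_toSet).2 fun G hG => ?_
    by_cases hne : G = F
    · exact Eventually.of_forall fun y h => absurd hne h
    · filter_upwards [T.ae_notMem_closure_face hF hG hne] with y hy _ using hy
  filter_upwards [h1, h2, h3] with y hy1 hy2 hy3 hyc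
  have hyF : y ∈ F := by
    by_contra h
    exact hy1 ⟨hyc, h⟩
  refine ⟨hyF, ?_⟩
  obtain ⟨ε, hε, hout⟩ := hy2 hyF
  have hyp : inner ℝ (T.normal F) y = T.offset F := T.face_subset_plane hF hyF
  refine ⟨hyp, ?_⟩
  have hnn : inner ℝ (T.normal F) (T.normal F) = 1 := by
    rw [real_inner_self_eq_norm_sq, T.norm_normal F hF, one_pow]
  have hcl : IsClosed (⋃ G ∈ {G | G ∈ T.faces ∧ G ≠ F}, closure G) :=
    Set.Finite.isClosed_biUnion (T.faces.finite_toSet.subset fun G hG => hG.1)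
      fun G _ => isClosed_closure
  have hynot : y ∈ (⋃ G ∈ {G | G ∈ T.faces ∧ G ≠ F}, closure G)ᶜ := by
    simp only [mem_compl_iff, mem_iUnion, not_exists]
    exact fun G hG => hy3 G hG.1 hG.2 hyF
  obtain ⟨ρ, hρ, hball⟩ := Metric.isOpen_iff.1 hcl.isOpen_compl y hynot
  -- In a ball away from the other closed faces the frontier lies in the plane of `F`. Each open
  -- half ball is convex, so it lies inside or outside `T`; the points y ∓ t n decide which.
  have hfr : ∀ x ∈ Metric.ball y ρ, x ∈ frontier T.carrier →
      inner ℝ (T.normal F) x = T.offset F := by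
    intro x hx hxf
    rw [T.frontier_eq] at hxf
    obtain ⟨G, hG, hxG⟩ := mem_iUnion₂.1 hxf
    by_cases hne : G = F
    · exact hne ▸ T.closure_face_subset_plane hG hxG
    · exact absurd (mem_iUnion₂.2 ⟨G, ⟨hG, hne⟩, hxG⟩) (hball hx)
  have hnball : ∀ t : ℝ, |t| < ρ → y + t • T.normal F ∈ Metric.ball y ρ := by
    intro t ht
    rw [Metric.mem_ball, dist_eq_norm, add_sub_cancel_left, norm_smul, T.norm_normal F hF, mul_one]
    exact ht
  have hlin : IsLinearMap ℝ fun x : Eucl d => inner ℝ (T.normal F) x :=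
    ⟨fun x y => inner_add_right _ _ _, fun r x => inner_smul_right _ _ _⟩
  obtain ⟨t, ht0, ht⟩ := exists_between (lt_min hε hρ)
  have htε := ht.trans_le (min_le_left _ _)
  have htρ := ht.trans_le (min_le_right _ _)
  refine ⟨ρ, hρ, fun x hx hlt => ?_, fun x hx hlt hxT => ?_⟩
  · refine T.subset_of_isPreconnected (A := Metric.ball y ρ ∩ {x | inner ℝ (T.normal F) x < T.offset F})
      ((convex_ball y ρ).inter (convex_halfSpace_lt hlin _)).isPreconnected ?_ ?_ ⟨hx, hlt⟩
    · rw [Set.disjoint_left]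
      exact fun z hz hzf => (hz.2 : _ < _).ne (hfr z hz.1 hzf)
    · refine ⟨y - t • T.normal F, ⟨?_, ?_⟩, (hout t ⟨ht0, htε⟩).1⟩
      · rw [sub_eq_add_neg, ← neg_smul]
        exact hnball _ (by rwa [abs_neg, abs_of_pos ht0])
      · change inner ℝ _ _ < _
        rw [inner_sub_right, inner_smul_right, hnn, hyp]
        linarith
  · refine (hout t ⟨ht0, htε⟩).2 (T.subset_of_isPreconnected
      (A := Metric.ball y ρ ∩ {x | T.offset F < inner ℝ (T.normal F) x})
      ((convex_ball y ρ).inter (convex_halfSpace_gt hlin _)).isPreconnected ?_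
      ⟨x, ⟨hx, hlt⟩, hxT⟩ ⟨?_, ?_⟩)
    · rw [Set.disjoint_left]
      exact fun z hz hzf => (hz.2 : _ < _).ne' (hfr z hz.1 hzf)
    · exact hnball _ (by rwa [abs_of_pos ht0])
    · change _ < inner ℝ _ _
      rw [inner_add_right, inner_smul_right, hnn, hyp]
      linarith

/-! ### Convex cells and integrability of the trace -/

/-- The cell of the arrangement of the hyperplanes of the faces that lies above the hyperplanes of
the faces in `A` and below the other ones. -/
def cell (T : PolyhedralElement d) (A : Finset (Set (Eucl d))) : Set (Eucl d) :=
  ⋂ F ∈ T.faces, {x | (F ∈ A → T.offset F < inner ℝ (T.normal F) x) ∧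
    (F ∉ A → inner ℝ (T.normal F) x < T.offset F)}

theorem isOpen_cell (T : PolyhedralElement d) (A : Finset (Set (Eucl d))) : IsOpen (T.cell A) := by
  refine isOpen_biInter_finset fun F _ => ?_
  by_cases h : F ∈ A
  · simpa [h] using isOpen_lt continuous_const (by fun_prop)
  · simpa [h] using isOpen_lt (by fun_prop) continuous_const

theorem convex_cell (T : PolyhedralElement d) (A : Finset (Set (Eucl d))) :
    Convex ℝ (T.cell A) := by
  refine convex_iInter₂ fun F _ => ?_
  have hlin : IsLinearMap ℝ fun x : Eucl d => inner ℝ (T.normal F) x :=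
    ⟨fun x y => inner_add_right _ _ _, fun r x => inner_smul_right _ _ _⟩
  by_cases h : F ∈ A
  · simpa [h] using convex_halfSpace_gt hlin _
  · simpa [h] using convex_halfSpace_lt hlin _

theorem notMem_plane_of_mem_cell (T : PolyhedralElement d) {A : Finset (Set (Eucl d))}
    {F x : _} (hF : F ∈ T.faces) (hx : x ∈ T.cell A) : x ∉ T.plane F := by
  intro h
  have h' : inner ℝ (T.normal F) x = T.offset F := h
  have := mem_iInter₂.1 hx F hF
  by_cases hA : F ∈ A
  · exact (this.1 hA).ne' h'
  · exact (this.2 hA).ne h'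

theorem cell_subset (T : PolyhedralElement d) {A : Finset (Set (Eucl d))}
    (hne : (T.cell A ∩ T.carrier).Nonempty) : T.cell A ⊆ T.carrier := by
  refine T.subset_of_isPreconnected (T.convex_cell A).isPreconnected ?_ hne
  rw [Set.disjoint_left]
  intro x hx hxf
  obtain ⟨F, hF, hxF⟩ := mem_iUnion₂.1 (T.frontier_subset hxf)
  exact T.notMem_plane_of_mem_cell hF hx hxF

-- The face hyperplanes are null, so their complement is dense, and a point off them belongs to the
-- cell given by its signs. Finiteness lets the closure pass through the union.
open Classical in
theorem closure_subset_cells (T : PolyhedralElement d) :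
    closure T.carrier ⊆ ⋃ A ∈ T.faces.powerset.filter fun A => (T.cell A ∩ T.carrier).Nonempty,
      closure (T.cell A) := by
  have hnull : ∀ᵐ x : Eucl d, x ∈ (⋃ F ∈ T.faces, T.plane F)ᶜ := by
    refine measure_eq_zero_iff_ae_notMem.1 ?_
    exact (measure_biUnion_null_iff T.faces.countable_toSet).2 fun F hF =>
      volume_hyperplane (T.norm_normal F hF) _
  have hdense := Measure.dense_of_ae hnull
  rw [← Finset.closure_biUnion]
  refine closure_minimal ((hdense.open_subset_closure_inter T.isOpen_carrier).trans
    (closure_mono ?_)) isClosed_closure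
  rintro x ⟨hxT, hx⟩
  simp only [mem_compl_iff, mem_iUnion, not_exists] at hx
  have hcell : x ∈ T.cell (T.faces.filter fun F => T.offset F < inner ℝ (T.normal F) x) := by
    refine mem_iInter₂.2 fun F hF => ⟨fun h => (Finset.mem_filter.1 h).2, fun h => ?_⟩
    have h1 : ¬ T.offset F < inner ℝ (T.normal F) x := fun h' => h (Finset.mem_filter.2 ⟨hF, h'⟩)
    exact lt_of_le_of_ne (not_lt.1 h1) (hx F hF)
  refine mem_iUnion₂.2 ⟨_, Finset.mem_filter.2 ⟨?_, x, hcell, hxT⟩, hcell⟩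
  exact Finset.mem_powerset.2 (Finset.filter_subset _ _)

/-- The trace of a weakly differentiable function is integrable on the faces. -/
theorem integrableOn_trace (T : PolyhedralElement d) {v : Eucl d → ℝ} (hv : Integrable v)
    (hvm : Measurable v)
    (h : ∀ e, ∃ g, Integrable g ∧ Measurable g ∧ IsWeakDeriv T.carrier e v g)
    {F : Set (Eucl d)} (hF : F ∈ T.faces) :
    IntegrableOn (trace T.carrier v) F (T.planeMeasure F) := by
  classical
  have hlf := T.isLocallyFinite_planeMeasure hF
  have hn := T.norm_normal F hF
  have hcover : F ⊆ ⋃ A ∈ T.faces.powerset.filter fun A => (T.cell A ∩ T.carrier).Nonempty,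
      closure F ∩ closure (T.cell A) := by
    intro y hy
    have h1 := T.closure_subset_cells (frontier_subset_closure
      (T.closure_face_subset_frontier hF (subset_closure hy)))
    obtain ⟨A, hA, hyA⟩ := mem_iUnion₂.1 h1
    exact mem_iUnion₂.2 ⟨A, hA, subset_closure hy, hyA⟩
  refine IntegrableOn.mono_set ?_ hcover
  refine (integrableOn_finset_iUnion).2 fun A hA => ?_
  obtain ⟨-, hAne⟩ := Finset.mem_filter.1 hA
  have hAT := T.cell_subset hAne
  by_cases hFA : F ∈ A
  -- Such a cell is part of `T` above the plane of `F`, whereas near a flat point `T` has no point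
  -- above it.
  · have hnull : T.planeMeasure F (closure F ∩ closure (T.cell A)) = 0 := by
      rw [measure_eq_zero_iff_ae_notMem]
      filter_upwards [T.ae_isFlatPoint hF] with y hy hyK
      obtain ⟨-, -, ρ, hρ, -, hup⟩ := hy hyK.1
      obtain ⟨z, hzb, hzA⟩ := mem_closure_iff.1 hyK.2 _ Metric.isOpen_ball
        (Metric.mem_ball_self hρ)
      exact hup z hzb ((mem_iInter₂.1 hzA F hF).1 hFA) (hAT hzA)
    rw [IntegrableOn, Measure.restrict_eq_zero.2 hnull]
    exact integrable_zero_measure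
  · have hK : IsCompact (closure F ∩ closure (T.cell A)) :=
      (T.isCompact_closure_face hF).inter_right isClosed_closure
    refine LocallyIntegrableOn.integrableOn_isCompact (fun y₀ hy₀ => ?_) hK
    obtain ⟨x, hxA, -⟩ := hAne
    -- Aim from y₀ at a point x of the open cell. For y near y₀ in the closed cell, y + e is near x,
    -- hence in the cell, and by convexity y + se is in it for all 0 < s < 1: a uniform length. As e
    -- varies with y₀, weak derivatives in all directions are required.
    set e := x - y₀ with he
    have hen : inner ℝ (T.normal F) e < 0 := by
      have h1 : inner ℝ (T.normal F) x < T.offset F := (mem_iInter₂.1 hxA F hF).2 hFA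
      have h2 : inner ℝ (T.normal F) y₀ = T.offset F := T.closure_face_subset_plane hF hy₀.1
      rw [he, inner_sub_right, h2]
      linarith
    obtain ⟨g, hg, hgm, hweak⟩ := h e
    obtain ⟨r, hr, hball⟩ := Metric.isOpen_iff.1 (T.isOpen_cell A) x hxA
    let S : Set (Eucl d) := Metric.ball y₀ r ∩ (closure F ∩ closure (T.cell A))
    have hS : MeasurableSet S := measurableSet_ball.inter
      (isClosed_closure.inter isClosed_closure).measurableSet
    have hseg : ∀ y ∈ S, ∀ s ∈ Ioo (0 : ℝ) 1, y + s • e ∈ T.carrier := by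
      rintro y ⟨hyb, -, hyA⟩ s hs
      have h1 : x + (y - y₀) ∈ interior (T.cell A) := by
        rw [(T.isOpen_cell A).interior_eq]
        refine hball ?_
        rw [Metric.mem_ball, dist_eq_norm] at hyb ⊢
        rwa [add_sub_cancel_left]
      have h2 := (T.convex_cell A).combo_closure_interior_mem_interior hyA h1
        (a := 1 - s) (b := s) (by linarith [hs.2]) hs.1 (by ring)
      have h3 : (1 - s) • y + s • (x + (y - y₀)) = y + s • e := by
        rw [he]
        module
      rw [h3] at h2
      exact hAT (interior_subset h2)
    obtain ⟨b, hb, hbl⟩ := exists_integrable_hasLineLimit T.isOpen_carrier hn hen.ne hv hvm hg hgm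
      hweak hS one_pos hseg
    refine ⟨S, ?_, ?_⟩
    · exact inter_mem (mem_nhdsWithin_of_mem_nhds (Metric.ball_mem_nhds _ hr)) self_mem_nhdsWithin
    · refine (hb.integrableOn (s := S)).congr_fun_ae ?_
      rw [EventuallyEq, ae_restrict_iff' hS]
      filter_upwards [hbl, T.ae_isFlatPoint hF,
        ae_hasLineLimit_trace T.isOpen_carrier hn hen hv hvm hg hgm hweak] with y h1 h2 h3 hyS
      exact HasLineLimit.unique one_pos one_pos (h1 hyS)
        (h3 (h2 hyS.2.1).2 1 one_pos (hseg y hyS))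

end PolyhedralElement

/-! ### Exit layers -/

/-- The projection along `e` of a null set of a transversal hyperplane is null. -/
theorem volume_cylinder_eq_zero {n e : Eucl d} {c : ℝ} (hn : ‖n‖ = 1) (he : inner ℝ n e ≠ 0)
    {N : Set (Eucl d)} (hN : hyperMeasure n c N = 0) (hNH : N ⊆ hyperplane n c) :
    volume {x | ∃ s : ℝ, x + s • e ∈ N} = 0 := by
  have hlf := isLocallyFiniteMeasure_hyper hn c
  set N' := toMeasurable (hyperMeasure n c) N with hN'
  have hN'm : MeasurableSet N' := measurableSet_toMeasurable _ _
  have hN'0 : hyperMeasure n c N' = 0 := by rw [hN', measure_toMeasurable, hN]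
  -- Projection onto the hyperplane parallel to `e`. In the coordinates (y, s) it is (y, s) ↦ y, so
  -- the preimage of a null set is a null product set.
  let P : Eucl d → Eucl d := fun x => x + ((c - inner ℝ n x) / inner ℝ n e) • e
  have hP : Measurable P := by
    have : Continuous P := by fun_prop
    exact this.measurable
  have hsub : {x | ∃ s : ℝ, x + s • e ∈ N} ⊆ P ⁻¹' N' := by
    rintro x ⟨s, hs⟩
    have h1 : inner ℝ n (x + s • e) = c := hNH hs
    rw [inner_add_right, inner_smul_right] at h1
    have h2 : (c - inner ℝ n x) / inner ℝ n e = s := by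
      rw [div_eq_iff he]
      linarith
    change x + ((c - inner ℝ n x) / inner ℝ n e) • e ∈ N'
    rw [h2]
    exact subset_toMeasurable _ _ hs
  refine measure_mono_null hsub ?_
  have hmap := congrArg (fun μ => μ (P ⁻¹' N')) (map_hyperMeasure_prod (c := c) hn he)
  simp only [Measure.smul_apply, smul_eq_mul] at hmap
  rw [Measure.map_apply (by fun_prop) (hP hN'm)] at hmap
  have hzero : ((hyperMeasure n c).prod volume)
      ((fun p : Eucl d × ℝ => p.1 + p.2 • e) ⁻¹' (P ⁻¹' N')) = 0 := by
    have hm : Measurable fun p : Eucl d × ℝ => p.1 + p.2 • e := by fun_prop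
    rw [Measure.measure_prod_null (hm (hP hN'm))]
    filter_upwards [ae_mem_hyperplane n c, measure_eq_zero_iff_ae_notMem.1 hN'0] with y hy hyN
    have : Prod.mk y ⁻¹' ((fun p : Eucl d × ℝ => p.1 + p.2 • e) ⁻¹' (P ⁻¹' N')) = ∅ := by
      ext s
      simp only [mem_preimage, mem_empty_iff_false, iff_false, P]
      have h1 : (c - inner ℝ n (y + s • e)) / inner ℝ n e = -s := by
        rw [inner_add_right, inner_smul_right, show inner ℝ n y = c from hy, div_eq_iff he]
        ring
      rw [h1, neg_smul, add_neg_cancel_right]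
      exact hyN
    rw [this]
    simp
  rw [hzero] at hmap
  rcases mul_eq_zero.1 hmap.symm with h | h
  · rw [ENNReal.ofReal_eq_zero] at h
    exact absurd (abs_nonpos_iff.1 h) (inv_ne_zero he)
  · exact h

namespace PolyhedralElement

/-- The points of `T` that leave `T` through the face `F` when moving by at most `τ e`. -/
def layer (T : PolyhedralElement d) (e : Eucl d) (F : Set (Eucl d)) (τ : ℝ) : Set (Eucl d) :=
  {x | ∃ s ∈ Ioc 0 τ, x + s • e ∈ F ∧ ∀ s' ∈ Ico 0 s, x + s' • e ∈ T.carrier}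

theorem notMem_carrier_of_mem_face (T : PolyhedralElement d) {F : Set (Eucl d)} (hF : F ∈ T.faces)
    {x : Eucl d} (hx : x ∈ F) : x ∉ T.carrier := by
  have h := T.closure_face_subset_frontier hF (subset_closure hx)
  rw [frontier, T.isOpen_carrier.interior_eq] at h
  exact h.2

theorem layer_subset (T : PolyhedralElement d) (e : Eucl d) {F : Set (Eucl d)} (hF : F ∈ T.faces)
    (τ : ℝ) : T.layer e F τ ⊆ T.carrier \ segSet T.carrier e τ := by
  rintro x ⟨s, hs, hxF, hxT⟩
  refine ⟨by simpa using hxT 0 ⟨le_rfl, hs.1⟩, fun h => ?_⟩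
  exact T.notMem_carrier_of_mem_face hF hxF (h s ⟨hs.1.le, hs.2⟩)

theorem disjoint_layer (T : PolyhedralElement d) (e : Eucl d) {F G : Set (Eucl d)}
    (hF : F ∈ T.faces) (hG : G ∈ T.faces) (hne : F ≠ G) (τ : ℝ) :
    Disjoint (T.layer e F τ) (T.layer e G τ) := by
  rw [Set.disjoint_left]
  rintro x ⟨s, hs, hxF, hxT⟩ ⟨t, ht, hxG, hxT'⟩
  rcases lt_trichotomy s t with h | h | h
  · exact T.notMem_carrier_of_mem_face hF hxF (hxT' s ⟨hs.1.le, h⟩)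
  · subst h
    exact (T.face_disjoint F hF G hG hne).ne_of_mem hxF hxG rfl
  · exact T.notMem_carrier_of_mem_face hG hxG (hxT t ⟨ht.1.le, h⟩)

/-- The exit time must be the explicit time σ at which the line meets the plane of `F`. The
condition on the half-open segment is a countable intersection of conditions on compact segments,
each open in x. -/
theorem measurableSet_layer (T : PolyhedralElement d) {e : Eucl d} {F : Set (Eucl d)}
    (hF : F ∈ T.faces) (he : inner ℝ (T.normal F) e ≠ 0) (τ : ℝ) :
    MeasurableSet (T.layer e F τ) := by
  let σ : Eucl d → ℝ := fun x => (T.offset F - inner ℝ (T.normal F) x) / inner ℝ (T.normal F) e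
  have hσ : Continuous σ := by fun_prop
  have heq : T.layer e F τ = {x | σ x ∈ Ioc 0 τ} ∩ {x | x + σ x • e ∈ F} ∩
      ⋂ k : ℕ, {x | ∀ θ ∈ Icc (0 : ℝ) (1 - 1 / (k + 1)), x + (θ * σ x) • e ∈ T.carrier} := by
    ext x
    simp only [mem_inter_iff, mem_iInter, mem_ofPred_eq, layer]
    constructor
    · rintro ⟨s, hs, hxF, hxT⟩
      have h1 : inner ℝ (T.normal F) (x + s • e) = T.offset F := T.face_subset_plane hF hxF
      have h2 : σ x = s := by
        rw [inner_add_right, inner_smul_right] at h1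
        simp only [σ]
        rw [div_eq_iff he]
        linarith
      rw [h2]
      refine ⟨⟨hs, hxF⟩, fun k θ hθ => hxT _ ⟨mul_nonneg hθ.1 hs.1.le, ?_⟩⟩
      have : (0 : ℝ) < 1 / (k + 1) := by positivity
      have h3 : θ < 1 := by linarith [hθ.2]
      nlinarith [hs.1]
    · rintro ⟨⟨hs, hxF⟩, hxT⟩
      refine ⟨σ x, hs, hxF, fun s hsx => ?_⟩
      have h0 : 0 < 1 - s / σ x := by
        rw [sub_pos, div_lt_one hs.1]
        exact hsx.2
      obtain ⟨k, hk⟩ := exists_nat_one_div_lt h0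
      have := hxT k (s / σ x) ⟨div_nonneg hsx.1 hs.1.le, by linarith⟩
      rwa [div_mul_cancel₀ _ hs.1.ne'] at this
  rw [heq]
  refine ((hσ.measurable measurableSet_Ioc).inter ?_).inter (MeasurableSet.iInter fun k => ?_)
  · have hc : Continuous fun x => x + σ x • e := by fun_prop
    exact hc.measurable (T.measurableSet_face hF)
  · refine IsOpen.measurableSet (isOpen_iff_mem_nhds.2 fun x hx => ?_)
    refine isCompact_Icc.eventually_forall_of_forall_eventually fun θ hθ => ?_
    have : Continuous fun z : Eucl d × ℝ => z.1 + (z.2 * σ z.1) • e := by fun_prop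
    exact this.continuousAt.eventually_mem (T.isOpen_carrier.mem_nhds (hx θ hθ))

/-- Almost every line of direction `e` meets the boundary at flat points of transversal faces
only. -/
theorem ae_forall_flat (T : PolyhedralElement d) (e : Eucl d) :
    ∀ᵐ x : Eucl d, ∀ s : ℝ, x + s • e ∈ frontier T.carrier →
      ∃ F ∈ T.faces, inner ℝ (T.normal F) e ≠ 0 ∧ x + s • e ∈ F ∧
        IsFlatPoint T.carrier (T.normal F) (T.offset F) (x + s • e) := by
  have key : ∀ F ∈ T.faces, ∀ᵐ x : Eucl d, ∀ s : ℝ, x + s • e ∈ closure F →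
      inner ℝ (T.normal F) e ≠ 0 ∧ x + s • e ∈ F ∧
        IsFlatPoint T.carrier (T.normal F) (T.offset F) (x + s • e) := by
    intro F hF
    by_cases he : inner ℝ (T.normal F) e = 0
    -- A line parallel to the plane meets it only if it is contained in it, which puts x in a null
    -- set.
    · have h0 := volume_hyperplane (T.norm_normal F hF) (T.offset F)
      filter_upwards [measure_eq_zero_iff_ae_notMem.1 h0] with x hx s hs
      refine absurd ?_ hx
      have h1 : inner ℝ (T.normal F) (x + s • e) = T.offset F := T.closure_face_subset_plane hF hs
      rwa [inner_add_right, inner_smul_right, he, mul_zero, add_zero] at h1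
    · have h0 := T.ae_isFlatPoint hF
      rw [ae_iff] at h0
      have h1 := volume_cylinder_eq_zero (T.norm_normal F hF) he h0 fun y hy => by
        simp only [mem_ofPred_eq, Classical.not_imp] at hy
        exact T.closure_face_subset_plane hF hy.1
      filter_upwards [measure_eq_zero_iff_ae_notMem.1 h1] with x hx s hs
      refine ⟨he, ?_⟩
      by_contra hcon
      exact hx ⟨s, fun H => hcon (H hs)⟩
  have hall := (ae_ball_iff T.faces.countable_toSet).2 key
  filter_upwards [hall] with x hx s hs
  rw [T.frontier_eq] at hs
  obtain ⟨F, hF, hxF⟩ := mem_iUnion₂.1 hs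
  exact ⟨F, hF, hx F hF s hxF⟩

/-- Almost every point of `T` leaving `T` when moving by at most `τ e` does so through a face whose
normal makes an acute angle with `e`. -/
theorem ae_mem_layer (T : PolyhedralElement d) (e : Eucl d) (τ : ℝ) :
    ∀ᵐ x : Eucl d, x ∈ T.carrier \ segSet T.carrier e τ →
      ∃ F ∈ T.faces, 0 < inner ℝ (T.normal F) e ∧ x ∈ T.layer e F τ := by
  filter_upwards [T.ae_forall_flat e] with x hx hxm
  obtain ⟨hxT, hxs⟩ := hxm
  simp only [segSet, mem_ofPred_eq, not_forall] at hxs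
  obtain ⟨t, ht, htT⟩ := hxs
  have hline : Continuous fun s : ℝ => x + s • e := by fun_prop
  have hclosed : IsClosed ((fun s : ℝ => x + s • e) ⁻¹' T.carrierᶜ) :=
    T.isOpen_carrier.isClosed_compl.preimage hline
  obtain ⟨s, ⟨hs, hsT⟩, hmin⟩ := (isCompact_Icc.inter_right hclosed).exists_isLeast ⟨t, ht, htT⟩
  have hs0 : 0 < s := by
    refine lt_of_le_of_ne hs.1 fun h => hsT ?_
    rw [← h]
    simpa using hxT
  have hbefore : ∀ s' ∈ Ico 0 s, x + s' • e ∈ T.carrier := by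
    intro s' hs'
    by_contra hcon
    exact absurd (hmin ⟨⟨hs'.1, hs'.2.le.trans hs.2⟩, hcon⟩) (not_le.2 hs'.2)
  have hlim : Tendsto (fun s' : ℝ => x + s' • e) (𝓝[<] s) (𝓝 (x + s • e)) :=
    (hline.tendsto s).mono_left nhdsWithin_le_nhds
  have hfr : x + s • e ∈ frontier T.carrier := by
    rw [frontier, T.isOpen_carrier.interior_eq]
    refine ⟨mem_closure_of_tendsto hlim ?_, hsT⟩
    filter_upwards [Ioo_mem_nhdsLT hs0] with s' hs' using hbefore s' ⟨hs'.1.le, hs'.2⟩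
  obtain ⟨F, hF, hne, hxF, hyc, ρ, hρ, -, hup⟩ := hx s hfr
  refine ⟨F, hF, ?_, s, ⟨hs0, hs.2⟩, hxF, hbefore⟩
  -- With n·e < 0 the line would be above the plane just before the exit time, where flatness leaves
  -- no point of `T`.
  refine lt_of_le_of_ne (not_lt.1 fun hneg => ?_) hne.symm
  have hev : ∀ᶠ s' in 𝓝[<] s, x + s' • e ∈ Metric.ball (x + s • e) ρ :=
    hlim.eventually_mem (Metric.ball_mem_nhds _ hρ)
  obtain ⟨s', h1, h2⟩ := (hev.and (Ioo_mem_nhdsLT hs0)).exists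
  refine hup _ h1 ?_ (hbefore s' ⟨h2.1.le, h2.2⟩)
  rw [inner_add_right, inner_smul_right] at hyc ⊢
  nlinarith [h2.2]

open Classical in
theorem setIntegral_exit_eq_sum (T : PolyhedralElement d) (e : Eucl d) (τ : ℝ) {v : Eucl d → ℝ}
    (hv : Integrable v) :
    ∫ x in T.carrier \ segSet T.carrier e τ, v x =
      ∑ F ∈ T.faces.filter fun F => 0 < inner ℝ (T.normal F) e, ∫ x in T.layer e F τ, v x := by
  rw [← integral_biUnion_finset]
  · refine setIntegral_congr_set ?_
    filter_upwards [T.ae_mem_layer e τ] with x hx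
    refine propext ⟨fun h => ?_, fun h => ?_⟩
    · obtain ⟨F, hF, hpos, hxF⟩ := hx h
      exact mem_iUnion₂.2 ⟨F, Finset.mem_filter.2 ⟨hF, hpos⟩, hxF⟩
    · obtain ⟨F, hF, hxF⟩ := mem_iUnion₂.1 h
      exact T.layer_subset e (Finset.mem_filter.1 hF).1 τ hxF
  · intro F hF
    exact T.measurableSet_layer (Finset.mem_filter.1 hF).1 (Finset.mem_filter.1 hF).2.ne' τ
  · intro F hF G hG hne
    exact T.disjoint_layer e (Finset.mem_filter.1 hF).1 (Finset.mem_filter.1 hG).1 hne τ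
  · exact fun F _ => hv.integrableOn

end PolyhedralElement

/-! ### Limits of rescaled layer integrals -/

theorem IsWeakDeriv.neg {T : Set (Eucl d)} {e : Eucl d} {v g : Eucl d → ℝ}
    (h : IsWeakDeriv T e v g) : IsWeakDeriv T (-e) v (-g) := by
  intro φ h1 h2 h3
  have := h φ h1 h2 h3
  simp only [map_neg, mul_neg, integral_neg, Pi.neg_apply, neg_mul, neg_neg, this]

theorem tendsto_average_primitive (γ : ℝ → ℝ) (hγ : Integrable γ) (a : ℝ) :
    Tendsto (fun τ : ℝ => τ⁻¹ * ∫ s in Ioc 0 τ, (a + ∫ t in (0 : ℝ)..s, γ t)) (𝓝[>] 0) (𝓝 a) := by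
  let w : ℝ → ℝ := fun s => a + ∫ t in (0 : ℝ)..s, γ t
  have hw : Continuous w := continuous_const.add
    (intervalIntegral.continuous_primitive (fun _ _ => hγ.intervalIntegrable) 0)
  have hd : HasDerivAt (fun τ => ∫ s in (0 : ℝ)..τ, w s) (w 0) 0 :=
    intervalIntegral.integral_hasDerivAt_right (hw.intervalIntegrable _ _)
      (hw.stronglyMeasurableAtFilter _ _) hw.continuousAt
  have h0 : w 0 = a := by simp [w]
  have ht := hd.tendsto_slope_zero_right
  rw [h0] at ht
  refine ht.congr' ?_
  filter_upwards [self_mem_nhdsWithin] with τ hτ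
  rw [zero_add, intervalIntegral.integral_same, sub_zero, smul_eq_mul,
    intervalIntegral.integral_of_le (le_of_lt hτ)]

namespace PolyhedralElement

/-- The layer of the points leaving `T` through a face, in the coordinates based on this face. -/
theorem add_smul_neg_mem_layer_iff (T : PolyhedralElement d) {e : Eucl d} {F : Set (Eucl d)}
    (hF : F ∈ T.faces) (he : inner ℝ (T.normal F) e ≠ 0) {y : Eucl d} (hy : y ∈ T.plane F)
    (τ s : ℝ) : y + s • (-e) ∈ T.layer e F τ ↔
      y ∈ F ∧ s ∈ Ioc 0 τ ∧ ∀ s' ∈ Ioc 0 s, y + s' • (-e) ∈ T.carrier := by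
  have hyc : inner ℝ (T.normal F) y = T.offset F := hy
  constructor
  · rintro ⟨t, ht, hxF, hxT⟩
    have h1 : inner ℝ (T.normal F) (y + s • (-e) + t • e) = T.offset F :=
      T.face_subset_plane hF hxF
    have hts : t = s := by
      rw [inner_add_right, inner_add_right, inner_smul_right, inner_smul_right, inner_neg_right,
        hyc] at h1
      have : (t - s) * inner ℝ (T.normal F) e = 0 := by linarith
      rcases mul_eq_zero.1 this with h | h
      · linarith
      · exact absurd h he
    subst hts
    have h2 : y + t • (-e) + t • e = y := by module
    rw [h2] at hxF
    refine ⟨hxF, ht, fun s' hs' => ?_⟩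
    have h3 := hxT (t - s') ⟨by linarith [hs'.2], by linarith [hs'.1]⟩
    have h4 : y + t • (-e) + (t - s') • e = y + s' • (-e) := by module
    rwa [h4] at h3
  · rintro ⟨hyF, hs, hT⟩
    refine ⟨s, hs, ?_, fun s' hs' => ?_⟩
    · have h2 : y + s • (-e) + s • e = y := by module
      rwa [h2]
    · have h4 : y + s • (-e) + s' • e = y + (s - s') • (-e) := by module
      rw [h4]
      exact hT _ ⟨by linarith [hs'.2], by linarith [hs'.1]⟩

/-- The rescaled integral over the boundary layer of a face tends to the weighted integral of the
trace on this face. -/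
theorem tendsto_integral_layer (T : PolyhedralElement d) {e : Eucl d} {F : Set (Eucl d)}
    (hF : F ∈ T.faces) (he : 0 < inner ℝ (T.normal F) e) {v g : Eucl d → ℝ}
    (hv : Integrable v) (hvm : Measurable v) (hg : Integrable g) (hgm : Measurable g)
    (h : IsWeakDeriv T.carrier e v g)
    (htr : IntegrableOn (trace T.carrier v) F (T.planeMeasure F)) :
    Tendsto (fun τ : ℝ => τ⁻¹ * ∫ x in T.layer e F τ, v x) (𝓝[>] 0)
      (𝓝 (inner ℝ (T.normal F) e * ∫ y in F, trace T.carrier v y ∂(surf d))) := by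
  have hlf := T.isLocallyFinite_planeMeasure hF
  have hn := T.norm_normal F hF
  have hFm := T.measurableSet_face hF
  have hen : inner ℝ (T.normal F) (-e) < 0 := by
    rw [inner_neg_right]
    linarith
  let f : ℝ → Eucl d → ℝ := fun τ => (T.layer e F τ).indicator v
  have hf : ∀ τ, Integrable (f τ) := fun τ => hv.indicator (T.measurableSet_layer hF he.ne' τ)
  -- The layer is described from its face, so lines are followed in the entering direction -e, along
  -- which the weak derivative is -g.
  have hrepr : ∀ τ : ℝ, τ⁻¹ * ∫ x in T.layer e F τ, v x = inner ℝ (T.normal F) e *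
      ∫ y, (τ⁻¹ * ∫ s : ℝ, f τ (y + s • (-e))) ∂(T.planeMeasure F) := by
    intro τ
    rw [← integral_indicator (T.measurableSet_layer hF he.ne' τ),
      integral_eq_hyper (c := T.offset F) hn hen.ne (hf τ), abs_of_neg hen, inner_neg_right,
      neg_neg, integral_const_mul, planeMeasure]
    ring
  simp_rw [hrepr]
  refine Tendsto.const_mul _ ?_
  rw [T.surf_restrict_face hF, ← integral_indicator hFm]
  have hmain : ∀ᵐ y ∂(T.planeMeasure F), y ∈ F → ∀ᵐ s : ℝ,
      (0 < s ∧ ∀ s' ∈ Ioc 0 s, y + s' • (-e) ∈ T.carrier) →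
      v (y + s • (-e)) = trace T.carrier v y + ∫ t in (0 : ℝ)..s, (-g) (y + t • (-e)) := by
    filter_upwards [T.ae_isFlatPoint hF,
      ae_hasLineLimit_trace T.isOpen_carrier hn hen hv hvm hg.neg hgm.neg h.neg] with y h1 h2 hyF
    -- The null set of exceptional s depends on the length of the segment. Rational lengths suffice
    -- since `T` is open, and they are countable.
    have h3 : ∀ q : ℚ, ∀ᵐ s : ℝ, (∀ s' ∈ Ioo (0 : ℝ) q, y + s' • (-e) ∈ T.carrier) →
        s ∈ Ioo (0 : ℝ) q →
        v (y + s • (-e)) = trace T.carrier v y + ∫ t in (0 : ℝ)..s, (-g) (y + t • (-e)) := by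
      intro q
      by_cases hq : (0 : ℝ) < q ∧ ∀ s' ∈ Ioo (0 : ℝ) q, y + s' • (-e) ∈ T.carrier
      · filter_upwards [h2 (h1 (subset_closure hyF)).2 q hq.1 hq.2] with s hs _ hm using hs hm
      · refine Eventually.of_forall fun s hs hm => ?_
        exact absurd ⟨hm.1.trans hm.2, hs⟩ hq
    filter_upwards [ae_all_iff.2 h3] with s hs hsT
    have hline : Continuous fun s : ℝ => y + s • (-e) := by fun_prop
    have hev : ∀ᶠ r in 𝓝 s, y + r • (-e) ∈ T.carrier := hline.continuousAt.eventually_mem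
      (T.isOpen_carrier.mem_nhds (hsT.2 s ⟨hsT.1, le_rfl⟩))
    obtain ⟨r, hr, hrT⟩ := Metric.eventually_nhds_iff.1 hev
    obtain ⟨q, hq1, hq2⟩ := exists_rat_btwn (show s < s + r by linarith)
    refine hs q (fun s' hs' => ?_) ⟨hsT.1, hq1⟩
    rcases le_or_gt s' s with hle | hlt
    · exact hsT.2 s' ⟨hs'.1, hle⟩
    · refine hrT ?_
      rw [Real.dist_eq, abs_of_pos (by linarith)]
      linarith [hs'.2]
  -- The dominating function is integrable thanks to `htr`; it bounds the mean of v over the part of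
  -- the line in the layer.
  refine tendsto_integral_filter_of_dominated_convergence
    (fun y => F.indicator (fun y => |trace T.carrier v y|) y + ∫ t : ℝ, |(-g) (y + t • (-e))|)
    ?_ ?_ ?_ ?_
  · exact Eventually.of_forall fun τ =>
      ((integrable_hyper_prod hn hen.ne (hf τ)).integral_prod_left.const_mul _).1
  · filter_upwards [self_mem_nhdsWithin] with τ hτ
    have hτ0 : (0 : ℝ) < τ := hτ
    filter_upwards [hmain, ae_mem_hyperplane (T.normal F) (T.offset F),
      ae_integrable_line (c := T.offset F) hn hen.ne hg.neg,
      ae_integrable_line (c := T.offset F) hn hen.ne (hf τ)] with y hy hyH hyg hyf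
    have hG : 0 ≤ ∫ t : ℝ, |(-g) (y + t • (-e))| := integral_nonneg fun _ => abs_nonneg _
    by_cases hyF : y ∈ F
    · rw [indicator_of_mem hyF, norm_mul, norm_inv, Real.norm_of_nonneg hτ0.le,
        inv_mul_le_iff₀ hτ0]
      set M := |trace T.carrier v y| + ∫ t : ℝ, |(-g) (y + t • (-e))| with hM
      have hM0 : 0 ≤ M := by positivity
      refine (norm_integral_le_integral_norm _).trans ?_
      have h1 : ∫ s : ℝ, ‖f τ (y + s • (-e))‖ ≤ ∫ s : ℝ, (Ioc 0 τ).indicator (fun _ => M) s := by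
        refine integral_mono_ae hyf.norm ((integrable_indicator_iff measurableSet_Ioc).2
          (integrableOn_const (by simp))) ?_
        filter_upwards [hy hyF] with s hs
        by_cases hmem : y + s • (-e) ∈ T.layer e F τ
        · obtain ⟨-, hsτ, hsT⟩ := (T.add_smul_neg_mem_layer_iff hF he.ne' hyH τ s).1 hmem
          simp only [f]
          rw [indicator_of_mem hmem, indicator_of_mem hsτ, hs ⟨hsτ.1, hsT⟩, Real.norm_eq_abs]
          exact (abs_add_le _ _).trans (add_le_add le_rfl (abs_intervalIntegral_le hyg s))
        · simp only [f]
          rw [indicator_of_notMem hmem, norm_zero]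
          exact indicator_nonneg (fun _ _ => hM0) _
      refine h1.trans_eq ?_
      rw [integral_indicator measurableSet_Ioc]
      simp [hτ0.le]
    · have h0 : ∀ s : ℝ, f τ (y + s • (-e)) = 0 := fun s => indicator_of_notMem
        (fun hmem => hyF ((T.add_smul_neg_mem_layer_iff hF he.ne' hyH τ s).1 hmem).1) _
      simp only [h0, integral_zero, mul_zero, norm_zero, indicator_of_notMem hyF, zero_add]
      exact hG
  · exact (IntegrableOn.integrable_indicator (f := fun y => |trace T.carrier v y|)
      htr.abs hFm).add (integrable_line_norm hn hen.ne hg.neg)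
  · filter_upwards [hmain, ae_mem_hyperplane (T.normal F) (T.offset F),
      ae_integrable_line (c := T.offset F) hn hen.ne hg.neg, T.ae_isFlatPoint hF]
      with y hy hyH hyg hyflat
    by_cases hyF : y ∈ F
    · rw [indicator_of_mem hyF]
      -- At a flat point a whole initial segment lies in `T`, so for small τ the layer is not
      -- truncated and its slice is exactly (0, τ].
      obtain ⟨δ, hδ, hδT⟩ := (hyflat (subset_closure hyF)).2.exists_add_smul_mem hen
      refine (tendsto_average_primitive _ hyg (trace T.carrier v y)).congr' ?_
      filter_upwards [Ioo_mem_nhdsGT hδ] with τ hτ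
      congr 1
      rw [← integral_indicator measurableSet_Ioc]
      refine integral_congr_ae ?_
      filter_upwards [hy hyF] with s hs
      by_cases hsm : s ∈ Ioc 0 τ
      · have hsT : ∀ s' ∈ Ioc 0 s, y + s' • (-e) ∈ T.carrier := fun s' hs' =>
          hδT s' ⟨hs'.1, by linarith [hs'.2, hsm.2, hτ.2]⟩
        have hmem := (T.add_smul_neg_mem_layer_iff hF he.ne' hyH τ s).2 ⟨hyF, hsm, hsT⟩
        simp only [f]
        rw [indicator_of_mem hsm, indicator_of_mem hmem, hs ⟨hsm.1, hsT⟩]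
      · simp only [f]
        rw [indicator_of_notMem hsm, indicator_of_notMem fun hmem =>
          hsm ((T.add_smul_neg_mem_layer_iff hF he.ne' hyH τ s).1 hmem).2.1]
    · rw [indicator_of_notMem hyF]
      have h0 : ∀ τ s : ℝ, f τ (y + s • (-e)) = 0 := fun τ s => indicator_of_notMem
        (fun hmem => hyF ((T.add_smul_neg_mem_layer_iff hF he.ne' hyH τ s).1 hmem).1) _
      simp only [h0, integral_zero, mul_zero]
      exact tendsto_const_nhds

end PolyhedralElement

/-! ### The divergence theorem -/

/-- The increments of `v` along the segments contained in `T`, in terms of the exit layers. -/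
theorem integral_segSet_increment {T : Set (Eucl d)} (hT : IsOpen T) (e : Eucl d)
    {v : Eucl d → ℝ} (hv : Integrable v) {τ : ℝ} (hτ : 0 ≤ τ) :
    ∫ x in segSet T e τ, (v (x + τ • e) - v x) =
      (∫ x in T \ segSet T e τ, v x) - ∫ x in T \ segSet T (-e) τ, v x := by
  have hm := (isOpen_segSet hT e τ).measurableSet
  have hm' := (isOpen_segSet hT (-e) τ).measurableSet
  -- Translation by τe reverses segments, exchanging the sets for e and -e; the two integrals over
  -- all of `T` then cancel.
  have hshift : ∀ x, x ∈ segSet T e τ ↔ x + τ • e ∈ segSet T (-e) τ := by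
    intro x
    simp only [segSet, mem_ofPred_eq]
    constructor
    · intro hx t ht
      have := hx (τ - t) ⟨by linarith [ht.2], by linarith [ht.1]⟩
      have h2 : x + τ • e + t • (-e) = x + (τ - t) • e := by module
      rwa [h2]
    · intro hx t ht
      have := hx (τ - t) ⟨by linarith [ht.2], by linarith [ht.1]⟩
      have h2 : x + τ • e + (τ - t) • (-e) = x + t • e := by module
      rwa [h2] at this
  have h1 : ∫ x in segSet T e τ, v (x + τ • e) = ∫ x in segSet T (-e) τ, v x := by
    rw [← integral_indicator hm, ← integral_indicator hm',
      ← integral_add_right_eq_self ((segSet T (-e) τ).indicator v) (τ • e)]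
    refine integral_congr_ae (Eventually.of_forall fun x => ?_)
    by_cases hx : x ∈ segSet T e τ
    · simp only [indicator_of_mem hx, indicator_of_mem ((hshift x).1 hx)]
    · simp only [indicator_of_notMem hx, indicator_of_notMem (mt (hshift x).2 hx)]
  rw [integral_sub (hv.comp_add_right (τ • e)).integrableOn hv.integrableOn, h1,
    setIntegral_sdiff hm hv.integrableOn (segSet_subset T e hτ),
    setIntegral_sdiff hm' hv.integrableOn (segSet_subset T (-e) hτ)]
  ring

/-- After Fubini, each t in (0, τ] contributes the integral of g over the translate of `segSet T e
τ` by te. It lies in `T` and misses only points of `R τ`, a set independent of t whose indicator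
tends to 0 pointwise. -/
theorem tendsto_integral_segSet {T : Set (Eucl d)} (hT : IsOpen T) (e : Eucl d)
    {g : Eucl d → ℝ} (hg : Integrable g) (hgm : Measurable g) :
    Tendsto (fun τ : ℝ => τ⁻¹ * ∫ x in segSet T e τ, ∫ t in (0 : ℝ)..τ, g (x + t • e)) (𝓝[>] 0)
      (𝓝 (∫ x in T, g x)) := by
  let R : ℝ → Set (Eucl d) := fun τ => T \ (segSet T e τ ∩ segSet T (-e) τ)
  have hR : ∀ τ, MeasurableSet (R τ) := fun τ => hT.measurableSet.diff
    ((isOpen_segSet hT e τ).measurableSet.inter (isOpen_segSet hT (-e) τ).measurableSet)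
  have hev : ∀ (e : Eucl d), ∀ x ∈ T, ∀ᶠ τ in 𝓝[>] (0 : ℝ), x ∈ segSet T e τ := by
    intro e x hx
    have hline : Continuous fun s : ℝ => x + s • e := by fun_prop
    have h1 : ∀ᶠ s in 𝓝 (0 : ℝ), x + s • e ∈ T :=
      hline.continuousAt.eventually_mem (hT.mem_nhds (by simpa using hx))
    obtain ⟨r, hr, hrT⟩ := Metric.eventually_nhds_iff.1 h1
    filter_upwards [Ioo_mem_nhdsGT hr] with τ hτ t ht
    refine hrT ?_
    rw [Real.dist_eq, sub_zero, abs_of_nonneg ht.1]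
    exact ht.2.trans_lt hτ.2
  have hRlim : Tendsto (fun τ => ∫ x in R τ, |g x|) (𝓝[>] 0) (𝓝 0) := by
    have h0 : Tendsto (fun τ => ∫ x, (R τ).indicator (fun x => |g x|) x) (𝓝[>] 0)
        (𝓝 (∫ _ : Eucl d, (0 : ℝ))) := by
      refine tendsto_integral_filter_of_dominated_convergence (fun x => |g x|)
        (Eventually.of_forall fun τ => (hg.abs.indicator (hR τ)).1) ?_ hg.abs ?_
      · refine Eventually.of_forall fun τ => Eventually.of_forall fun x => ?_
        refine (norm_indicator_le_norm_self _ _).trans_eq ?_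
        rw [Real.norm_eq_abs, abs_abs]
      · refine Eventually.of_forall fun x => ?_
        refine tendsto_const_nhds.congr' ?_
        by_cases hx : x ∈ T
        · filter_upwards [hev e x hx, hev (-e) x hx] with τ h1 h2
          exact (indicator_of_notMem (fun h => h.2 ⟨h1, h2⟩) _).symm
        · exact Eventually.of_forall fun τ => (indicator_of_notMem (fun h => hx h.1) _).symm
    rw [integral_zero] at h0
    refine h0.congr fun τ => ?_
    exact integral_indicator (hR τ)
  have hbound : ∀ τ > (0 : ℝ), ‖τ⁻¹ * (∫ x in segSet T e τ, ∫ t in (0 : ℝ)..τ, g (x + t • e)) -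
      ∫ x in T, g x‖ ≤ ∫ x in R τ, |g x| := by
    intro τ hτ
    have hm := (isOpen_segSet hT e τ).measurableSet
    let m : ℝ → ℝ := fun t => ∫ x in segSet T e τ, g (x + t • e)
    have hint : Integrable (fun p : Eucl d × ℝ => g (p.1 + p.2 • e))
        ((volume.restrict (segSet T e τ)).prod (volume.restrict (Ioc 0 τ))) :=
      (integrable_shift_prod hg hgm e τ).mono_measure
        (Measure.prod_mono Measure.restrict_le_self le_rfl)
    have hswap : ∫ x in segSet T e τ, ∫ t in (0 : ℝ)..τ, g (x + t • e) =
        ∫ t in (0 : ℝ)..τ, m t := by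
      simp_rw [intervalIntegral.integral_of_le hτ.le]
      exact integral_integral_swap (f := fun x t => g (x + t • e)) hint
    have hmint : IntervalIntegrable m volume 0 τ := by
      rw [intervalIntegrable_iff_integrableOn_Ioc_of_le hτ.le]
      exact hint.integral_prod_right
    have hm1 : ∀ t ∈ Ioc 0 τ, ‖m t - ∫ x in T, g x‖ ≤ ∫ x in R τ, |g x| := by
      intro t ht
      let W : Set (Eucl d) := (fun x => x - t • e) ⁻¹' segSet T e τ
      have hW : MeasurableSet W := (by fun_prop : Measurable fun x : Eucl d => x - t • e) hm
      have h1 : m t = ∫ x in W, g x := by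
        simp only [m]
        rw [← integral_indicator hm, ← integral_indicator hW,
          ← integral_add_right_eq_self (W.indicator g) (t • e)]
        refine integral_congr_ae (Eventually.of_forall fun x => ?_)
        have hiff : x + t • e ∈ W ↔ x ∈ segSet T e τ := by
          simp only [W, mem_preimage, add_sub_cancel_right]
        by_cases hx : x ∈ segSet T e τ
        · simp only [indicator_of_mem hx, indicator_of_mem (hiff.2 hx)]
        · simp only [indicator_of_notMem hx, indicator_of_notMem (mt hiff.1 hx)]
      have hWT : W ⊆ T := by
        intro x hx
        have := hx t ⟨ht.1.le, ht.2⟩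
        simpa using this
      rw [h1, norm_sub_rev, ← setIntegral_sdiff hW hg.integrableOn hWT]
      refine (norm_integral_le_integral_norm _).trans ?_
      refine setIntegral_mono_set hg.norm.integrableOn
        (Eventually.of_forall fun t => norm_nonneg _) (Eventually.of_forall fun x hx => ?_)
      refine ⟨hx.1, fun hx2 => hx.2 fun s hs => ?_⟩
      rcases le_total t s with hts | hts
      · have h3 := hx2.1 (s - t) ⟨by linarith, by linarith [hs.2, ht.1]⟩
        have h4 : x - t • e + s • e = x + (s - t) • e := by module
        rw [h4]
        exact h3
      · have h3 := hx2.2 (t - s) ⟨by linarith, by linarith [hs.1, ht.2]⟩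
        have h4 : x - t • e + s • e = x + (t - s) • (-e) := by module
        rw [h4]
        exact h3
    have h2 : τ⁻¹ * (∫ t in (0 : ℝ)..τ, m t) - ∫ x in T, g x =
        τ⁻¹ * ∫ t in (0 : ℝ)..τ, (m t - ∫ x in T, g x) := by
      rw [intervalIntegral.integral_sub hmint (by simp), intervalIntegral.integral_const, mul_sub,
        sub_zero, smul_eq_mul, inv_mul_cancel_left₀ hτ.ne']
    rw [hswap, h2, norm_mul, norm_inv, Real.norm_of_nonneg hτ.le, inv_mul_le_iff₀ hτ]
    have h3 := intervalIntegral.norm_integral_le_of_norm_le_const (a := 0) (b := τ)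
      (f := fun t => m t - ∫ x in T, g x) (C := ∫ x in R τ, |g x|)
      (by rw [uIoc_of_le hτ.le]; exact hm1)
    rwa [sub_zero, abs_of_pos hτ, mul_comm] at h3
  rw [tendsto_iff_norm_sub_tendsto_zero]
  refine squeeze_zero' (Eventually.of_forall fun _ => norm_nonneg _) ?_ hRlim
  filter_upwards [self_mem_nhdsWithin] with τ hτ using hbound τ hτ

/-- The divergence theorem on a polyhedral element. -/
theorem PolyhedralElement.integral_weakDeriv (T : PolyhedralElement d) {v : Eucl d → ℝ}
    (hv : Integrable v) (hvm : Measurable v)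
    (h : ∀ e, ∃ g, Integrable g ∧ Measurable g ∧ IsWeakDeriv T.carrier e v g)
    {e : Eucl d} {g : Eucl d → ℝ} (hg : Integrable g) (hgm : Measurable g)
    (hw : IsWeakDeriv T.carrier e v g) :
    ∫ x in T.carrier, g x = ∑ F ∈ T.faces, inner ℝ (T.normal F) e *
      ∫ y in F, trace T.carrier v y ∂(surf d) := by
  classical
  have hlim : ∀ (e : Eucl d) (g : Eucl d → ℝ), Integrable g → Measurable g →
      IsWeakDeriv T.carrier e v g →
      Tendsto (fun τ : ℝ => τ⁻¹ * ∫ x in T.carrier \ segSet T.carrier e τ, v x) (𝓝[>] 0)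
        (𝓝 (∑ F ∈ T.faces.filter fun F => 0 < inner ℝ (T.normal F) e, inner ℝ (T.normal F) e *
          ∫ y in F, trace T.carrier v y ∂(surf d))) := by
    intro e g hg hgm hw
    simp_rw [T.setIntegral_exit_eq_sum e _ hv, Finset.mul_sum]
    refine tendsto_finsetSum _ fun F hF => ?_
    obtain ⟨hF, hpos⟩ := Finset.mem_filter.1 hF
    exact T.tendsto_integral_layer hF hpos hv hvm hg hgm hw (T.integrableOn_trace hv hvm h hF)
  -- Entering along e is leaving along -e. The two sums collect the faces with n·e > 0 and n·e < 0,
  -- with matching signs; tangential faces contribute nothing.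
  have h1 := (hlim e g hg hgm hw).sub (hlim (-e) (-g) hg.neg hgm.neg hw.neg)
  have h2 := tendsto_integral_segSet T.isOpen_carrier e hg hgm
  have h3 : ∀ᶠ τ in 𝓝[>] (0 : ℝ),
      τ⁻¹ * (∫ x in T.carrier \ segSet T.carrier e τ, v x) -
        τ⁻¹ * (∫ x in T.carrier \ segSet T.carrier (-e) τ, v x) =
      τ⁻¹ * ∫ x in segSet T.carrier e τ, ∫ t in (0 : ℝ)..τ, g (x + t • e) := by
    filter_upwards [self_mem_nhdsWithin] with τ hτ
    have hτ0 : (0 : ℝ) ≤ τ := le_of_lt hτ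
    rw [← mul_sub, ← integral_segSet_increment T.isOpen_carrier e hv hτ0]
    congr 1
    refine setIntegral_congr_ae (isOpen_segSet T.isOpen_carrier e τ).measurableSet ?_
    filter_upwards [ae_translate T.isOpen_carrier hv hg hgm hw hτ0] with x hx hxs
    rw [hx hxs]
    ring
  rw [tendsto_nhds_unique h2 (h1.congr' h3), Finset.sum_filter, Finset.sum_filter,
    ← Finset.sum_sub_distrib]
  refine Finset.sum_congr rfl fun F _ => ?_
  rw [inner_neg_right]
  rcases lt_trichotomy (inner ℝ (T.normal F) e) 0 with hlt | heq | hgt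
  · rw [if_neg (by linarith), if_pos (by linarith)]
    ring
  · rw [heq]
    simp
  · rw [if_pos hgt, if_neg (by linarith)]
    ring

/-! ### Transfer to `H¹` functions and to constants -/

theorem trace_congr {T : Set (Eucl d)} {v w : Eucl d → ℝ}
    (h : v =ᵐ[volume.restrict T] w) : trace T v = trace T w := by
  -- Equality of the predicates makes the choices inside `trace` agree at every point, not merely
  -- almost everywhere.
  have h1 : IsTraceAt T v = IsTraceAt T w := by
    funext x a
    have h2 : ∀ r : ℝ, ⨍ y in T ∩ Metric.ball x r, |v y - a| =
        ⨍ y in T ∩ Metric.ball x r, |w y - a| := by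
      intro r
      rw [setAverage_eq, setAverage_eq]
      congr 1
      refine integral_congr_ae ?_
      filter_upwards [ae_restrict_of_ae_restrict_of_subset inter_subset_left h] with y hy
      rw [hy]
    simp only [IsTraceAt, h2]
  funext x
  unfold trace
  rw [h1]

theorem fderiv_eq_sum_partialDeriv (φ : Eucl d → ℝ) (x e : Eucl d) :
    fderiv ℝ φ x e = ∑ j, e j * partialDeriv j φ x := by
  have he : e = ∑ j, e j • EuclideanSpace.single j (1 : ℝ) := by
    have := (EuclideanSpace.basisFun (Fin d) ℝ).sum_repr e
    simpa using this.symm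
  conv_lhs => rw [he]
  simp [partialDeriv, map_sum]

theorem exists_measurable_rep {T : Set (Eucl d)} (hT : MeasurableSet T) {v : Eucl d → ℝ}
    (hv : IntegrableOn v T) :
    ∃ w : Eucl d → ℝ, Measurable w ∧ Integrable w ∧ w =ᵐ[volume] T.indicator v := by
  have h := hv.integrable_indicator hT
  exact ⟨h.1.mk _, h.1.stronglyMeasurable_mk.measurable, h.congr h.1.ae_eq_mk, h.1.ae_eq_mk.symm⟩

theorem integral_rep_mul {T : Set (Eucl d)} (hT : MeasurableSet T) {v w : Eucl d → ℝ}
    (hw : w =ᵐ[volume] T.indicator v) (ψ : Eucl d → ℝ) :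
    ∫ x, w x * ψ x = ∫ x in T, v x * ψ x := by
  rw [← integral_indicator hT]
  refine integral_congr_ae ?_
  filter_upwards [hw] with x hx
  rw [hx]
  by_cases hxT : x ∈ T <;> simp [hxT]

/-- Representatives of a function of `H¹` and of its weak partial derivatives which are measurable
and integrable on the whole space. -/
theorem exists_rep_of_memH1 (T : PolyhedralElement d) {v : Eucl d → ℝ} (hv : MemH1 T.carrier v) :
    ∃ (w : Eucl d → ℝ) (g : Fin d → Eucl d → ℝ), Measurable w ∧ Integrable w ∧
      w =ᵐ[volume.restrict T.carrier] v ∧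
      (∀ j, Measurable (g j) ∧ Integrable (g j) ∧
        g j =ᵐ[volume.restrict T.carrier] weakPartial T.carrier j v) ∧
      ∀ e : Eucl d, IsWeakDeriv T.carrier e w fun x => ∑ j, e j * g j x := by
  have hT := T.isOpen_carrier.measurableSet
  -- `T` being bounded, square integrable functions on it are integrable.
  have : IsFiniteMeasure (volume.restrict T.carrier) :=
    ⟨by rw [Measure.restrict_apply_univ]; exact T.isBounded_carrier.measure_lt_top⟩
  have hres : ∀ {u w : Eucl d → ℝ}, w =ᵐ[volume] T.carrier.indicator u →
      w =ᵐ[volume.restrict T.carrier] u := fun h =>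
    EventuallyEq.trans (ae_restrict_of_ae h) (indicator_ae_eq_restrict hT)
  obtain ⟨w, hwm, hwi, hw⟩ := exists_measurable_rep hT (hv.1.integrable one_le_two)
  choose g hgm hgi hg using fun j =>
    exists_measurable_rep hT ((weakPartial_spec hv j).1.integrable one_le_two)
  refine ⟨w, g, hwm, hwi, hres hw, fun j => ⟨hgm j, hgi j, hres (hg j)⟩, ?_⟩
  intro e φ hφ hc hs
  have hdc : ∀ j, Continuous (partialDeriv j φ) := fun j =>
    (hφ.continuous_fderiv (by simp)).clm_apply continuous_const
  have hdcs : ∀ j, HasCompactSupport (partialDeriv j φ) := fun j =>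
    (hc.fderiv (𝕜 := ℝ)).comp_left
      (g := fun L : Eucl d →L[ℝ] ℝ => L (EuclideanSpace.single j 1)) rfl
  have hi1 : ∀ j, Integrable fun x => e j * (w x * partialDeriv j φ x) := fun j => by
    obtain ⟨C, hC⟩ := (hdc j).bounded_above_of_compact_support (hdcs j)
    exact (hwi.mul_bdd (c := C) (hdc j).aestronglyMeasurable (Eventually.of_forall hC)).const_mul _
  have hi2 : ∀ j, Integrable fun x => e j * (g j x * φ x) := fun j => by
    obtain ⟨C, hC⟩ := hφ.continuous.bounded_above_of_compact_support hc
    exact ((hgi j).mul_bdd (c := C) hφ.continuous.aestronglyMeasurable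
      (Eventually.of_forall hC)).const_mul _
  have h1 : ∀ x, w x * fderiv ℝ φ x e = ∑ j, e j * (w x * partialDeriv j φ x) := by
    intro x
    rw [fderiv_eq_sum_partialDeriv, Finset.mul_sum]
    exact Finset.sum_congr rfl fun j _ => by ring
  have h2 : ∀ x, (∑ j, e j * g j x) * φ x = ∑ j, e j * (g j x * φ x) := by
    intro x
    rw [Finset.sum_mul]
    exact Finset.sum_congr rfl fun j _ => by ring
  simp_rw [h1, h2]
  rw [integral_finsetSum _ fun j _ => hi1 j, integral_finsetSum _ fun j _ => hi2 j,
    ← Finset.sum_neg_distrib]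
  refine Finset.sum_congr rfl fun j _ => ?_
  rw [integral_const_mul, integral_const_mul, integral_rep_mul hT hw, integral_rep_mul hT (hg j),
    (weakPartial_spec hv j).2 φ hφ hc hs, mul_neg]

/-- The divergence theorem for functions of `H¹`. -/
theorem integral_weakPartial (T : PolyhedralElement d) {v : Eucl d → ℝ} (hv : MemH1 T.carrier v)
    (j : Fin d) :
    ∫ x in T.carrier, weakPartial T.carrier j v x =
      ∑ F ∈ T.faces, T.normal F j * ∫ y in F, trace T.carrier v y ∂(surf d) := by
  obtain ⟨w, g, hwm, hwi, hw, hg, hweak⟩ := exists_rep_of_memH1 T hv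
  have hsum : ∀ e : Eucl d, Integrable (fun x => ∑ j, e j * g j x) ∧
      Measurable fun x => ∑ j, e j * g j x := fun e =>
    ⟨integrable_finsetSum _ fun j _ => (hg j).2.1.const_mul _,
      Finset.measurable_fun_sum _ fun j _ => (hg j).1.const_mul _⟩
  have hsingle : (fun x => ∑ k, (EuclideanSpace.single j (1 : ℝ) : Eucl d) k * g k x) = g j := by
    funext x
    simp
  have h := T.integral_weakDeriv hwi hwm
    (fun e => ⟨_, (hsum e).1, (hsum e).2, hweak e⟩) (hsum (EuclideanSpace.single j 1)).1
    (hsum _).2 (hweak _)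
  rw [hsingle, integral_congr_ae (hg j).2.2] at h
  rw [h, trace_congr hw]
  refine Finset.sum_congr rfl fun F _ => ?_
  rw [EuclideanSpace.inner_single_right]
  simp

/-- The divergence theorem for the indicator of `T`, whose weak derivatives on `T` vanish and whose
trace is 1 on the faces. -/
theorem sum_normal_mul_area (T : PolyhedralElement d) (j : Fin d) :
    ∑ F ∈ T.faces, T.normal F j * (surf d).real F = 0 := by
  have hT := T.isOpen_carrier.measurableSet
  let v : Eucl d → ℝ := T.carrier.indicator fun _ => 1
  have hvm : Measurable v := measurable_const.indicator hT
  have hvi : Integrable v := (integrable_indicator_iff hT).2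
    (integrableOn_const T.isBounded_carrier.measure_lt_top.ne)
  have hweak : ∀ e, IsWeakDeriv T.carrier e v fun _ => 0 := by
    intro e φ hφ hc hs
    have hdc : Continuous fun x => fderiv ℝ φ x e :=
      (hφ.continuous_fderiv (by simp)).clm_apply continuous_const
    have hdcs : HasCompactSupport fun x => fderiv ℝ φ x e :=
      (hc.fderiv (𝕜 := ℝ)).comp_left (g := fun L : Eucl d →L[ℝ] ℝ => L e) rfl
    -- The derivative of φ vanishes outside `T`, so the indicator can be replaced by the constant 1
    -- before integrating by parts.
    have h1 : ∀ x, v x * fderiv ℝ φ x e = 1 * fderiv ℝ φ x e := by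
      intro x
      by_cases hx : x ∈ T.carrier
      · simp [v, hx]
      · have : fderiv ℝ φ x = 0 := by
          by_contra hne
          exact hx (hs (support_fderiv_subset ℝ hne))
        simp [this]
    simp_rw [h1]
    rw [integral_mul_fderiv_eq_neg_fderiv_mul_of_integrable]
    · simp
    · simp
    · simpa using hdc.integrable_of_hasCompactSupport hdcs
    · simpa using hφ.continuous.integrable_of_hasCompactSupport hc
    · exact fun x _ => differentiableAt_const _
    · exact fun x _ => hφ.differentiable (by simp) x
  have h := T.integral_weakDeriv hvi hvm
    (fun e => ⟨_, integrable_zero _ _ _, measurable_const, hweak e⟩)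
    (g := fun _ => 0) (integrable_zero _ _ _) measurable_const
    (hweak (EuclideanSpace.single j 1))
  rw [integral_zero] at h
  rw [h]
  refine Finset.sum_congr rfl fun F hF => ?_
  have htr : ∀ y ∈ F, trace T.carrier v y = 1 := by
    intro y hy
    refine IsTraceAt.trace_eq T.isOpen_carrier hvi
      (frontier_subset_closure (T.closure_face_subset_frontier hF (subset_closure hy))) ?_
    have h0 : ∀ r : ℝ, ⨍ x in T.carrier ∩ Metric.ball y r, |v x - 1| = 0 := by
      intro r
      rw [setAverage_eq, setIntegral_congr_fun (g := fun _ => 0)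
        (hT.inter measurableSet_ball) fun x hx => by simp [v, hx.1]]
      simp
    simp only [IsTraceAt, h0]
    exact tendsto_const_nhds
  rw [setIntegral_congr_fun (T.measurableSet_face hF) htr, EuclideanSpace.inner_single_right]
  simp

/-! ### Commutation properties -/

theorem reconstructionGrad_interpolate (T : PolyhedralElement d) {v : Eucl d → Eucl d}
    (hv : MemH1Vec T.carrier v) :
    reconstructionGrad T (interpolate T v) =
      lprojMat volume T.carrier (weakJacobian T.carrier v) := by
  ext i j
  have harea : ∀ F ∈ T.faces, (surf d).real F *
      lproj (surf d) F (fun y => trace T.carrier (fun x => v x i) y) =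
      ∫ y in F, trace T.carrier (fun x => v x i) y ∂(surf d) := fun F hF =>
    measure_smul_setAverage _ (T.surf_face_lt_top hF).ne
  have hrhs : lprojMat volume T.carrier (weakJacobian T.carrier v) i j =
      (volume.real T.carrier)⁻¹ * ∑ F ∈ T.faces, T.normal F j *
        ∫ y in F, trace T.carrier (fun x => v x i) y ∂(surf d) := by
    rw [← integral_weakPartial T (hv i) j]
    exact setAverage_eq _ _ _
  have hlhs : reconstructionGrad T (interpolate T v) i j = ∑ F : T.faces,
      (surf d).real F.1 / volume.real T.carrier *
        ((lproj (surf d) F.1 (fun y => trace T.carrier (fun x => v x i) y) -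
          lproj volume T.carrier fun x => v x i) * T.normal F.1 j) := by
    simp only [reconstructionGrad, Matrix.sum_apply, Matrix.smul_apply, Matrix.of_apply, smul_eq_mul]
    rfl
  rw [hlhs, hrhs, Finset.sum_coe_sort T.faces fun F => (surf d).real F / volume.real T.carrier *
        ((lproj (surf d) F (fun y => trace T.carrier (fun x => v x i) y) -
          lproj volume T.carrier fun x => v x i) * T.normal F j)]
  -- The factor |F| cancels the normalisation of the face mean. The term with the element mean has a
  -- coefficient independent of `F`, so it is killed by `sum_normal_mul_area`.
  have hterm : ∀ F ∈ T.faces, (surf d).real F / volume.real T.carrier *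
        ((lproj (surf d) F (fun y => trace T.carrier (fun x => v x i) y) -
          lproj volume T.carrier fun x => v x i) * T.normal F j) =
      (volume.real T.carrier)⁻¹ * (T.normal F j *
        ∫ y in F, trace T.carrier (fun x => v x i) y ∂(surf d)) -
      (volume.real T.carrier)⁻¹ * (lproj volume T.carrier fun x => v x i) *
        (T.normal F j * (surf d).real F) := by
    intro F hF
    rw [← harea F hF]
    ring
  rw [Finset.sum_congr rfl hterm, Finset.sum_sub_distrib, ← Finset.mul_sum, ← Finset.mul_sum,
    sum_normal_mul_area, mul_zero, sub_zero]

/-- Each component of the reconstruction has the gradient and mean that characterise the elliptic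
projection. The affine maps coincide, so equality holds at every point of the space. -/
theorem reconstruction_interpolate_eq (T : PolyhedralElement d) {v : Eucl d → Eucl d}
    (hv : MemH1Vec T.carrier v) (x : Eucl d) :
    reconstruction T (interpolate T v) x = ellipticProjVec T v x := by
  obtain ⟨hgrad, hmean⟩ := reconstruction_spec T (interpolate T v)
  ext i
  let p : Eucl d →ᵃ[ℝ] ℝ := ((EuclideanSpace.proj i : Eucl d →L[ℝ] ℝ).toLinearMap.toAffineMap).comp
    (reconstruction T (interpolate T v))
  have hp : p = ellipticProj T fun y => v y i := by
    refine (existsUnique_affine T (fun j => lproj volume T.carrier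
      (weakPartial T.carrier j fun y => v y i)) (lproj volume T.carrier fun y => v y i)).unique
      ⟨fun x hx j => ?_, ?_⟩ (ellipticProj_spec T fun y => v y i)
    · have h := hgrad x hx
      rw [reconstructionGrad_interpolate T hv] at h
      exact congrFun (congrFun h i) j
    · exact congrArg (fun z : Eucl d => z i) hmean
  exact congrArg (fun q : Eucl d →ᵃ[ℝ] ℝ => q x) hp

end HHO

end

theorem proposition1 {d : ℕ} (hd : d = 2 ∨ d = 3) (T : HHO.PolyhedralElement d)
    (v : HHO.Eucl d → HHO.Eucl d) (hv : HHO.MemH1Vec T.carrier v) :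
    (∀ x ∈ T.carrier,
      HHO.jacobian (HHO.reconstruction T (HHO.interpolate T v)) x =
        HHO.lprojMat volume T.carrier (HHO.weakJacobian T.carrier v)) ∧
    (∀ x ∈ T.carrier,
      HHO.reconstruction T (HHO.interpolate T v) x = HHO.ellipticProjVec T v x) := by
  refine ⟨fun x hx => ?_, fun x _ => HHO.reconstruction_interpolate_eq T hv x⟩
  rw [(HHO.reconstruction_spec T (HHO.interpolate T v)).1 x hx,
    HHO.reconstructionGrad_interpolate T hv]
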